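/- Let $V=V_{\bar 0}\oplus V_{\bar 1}$ be a finite-dimensional complex superspace with $\dim V_{\bar 0}=m$, $\dim V_{\bar 1}=2n$, equipped with a non-degenerate even supersymmetric bilinear form $(\cdot,\cdot)$. Let $\mathfrak g=\mathfrak{osp}(V)=\mathfrak{osp}(m|2n)$, let $e\in\mathfrak g_{\bar 0}$ be nilpotent, and let $\mathfrak g^e=\{x\in\mathfrak g:[e,x]=0\}$, where $[\cdot,\cdot]$ is the superbracket. For subspaces $A,B$ write $[A,B]$ for the span of all $[a,b]$, $a\in A$, $b\in B$. Call the following data an adapted basis for $e$: integers $\lambda_1\ge\dots\ge\lambda_N\ge 1$; parities $\bar i\in\{\bar 0,\bar 1\}$ for $1\le i\le N$, such that $i<j$ whenever $\lambda_i=\lambda_j$, $\bar i=\bar 0$, $\bar j=\bar 1$; vectors $v_i\in V_{\bar i}$ with $e^{\lambda_i}v_i=0$ such that $\{e^av_i:1\le i\le N,\ 0\le a<\lambda_i\}$ is a basis of $V$; an involution $i\mapsto i^*$ of $\{1,\dots,N\}$ with $i^*\in\{i-1,i,i+1\}$, $\lambda_{i^*}=\lambda_i$, $\overline{i^*}=\bar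 i$, and $i^*=i$ if and only if ($\bar i=\bar 0$ and $\lambda_i$ is odd) or ($\bar i=\bar 1$ and $\lambda_i$ is even); and signs $\theta_i\in\{\pm1\}$ such that, for $0\le a<\lambda_i$, $0\le b<\lambda_j$, $(e^av_i,e^bv_j)=(-1)^a\theta_i$ if $j=i^*$ and $a+b=\lambda_i-1$, and $(e^av_i,e^bv_j)=0$ otherwise. Given an adapted basis, let $\xi_i^{j,k}$ be the endomorphism of $V$ with $\xi_i^{j,k}(e^av_i)=e^{a+k}v_j$ and $\xi_i^{j,k}(e^av_l)=0$ for $l\ne i$. Put $\varepsilon_{i,j,k}=(-1)^{\lambda_j-k-\bar x\,\bar i}\theta_j\theta_i$ with $\bar x=\bar i+\bar j$ (in $\mathbb Z/2$), and $\zeta_{i,j,k}=\xi_i^{j,\lambda_j-1-k}+\varepsilon_{i,j,k}\,\xi_{j^*}^{i^*,\lambda_i-1-k}$. Define $$N_1=\mathrm{Span}\{\xi_i^{i^*,\lambda_i-1-k}: i\ne i^*,\ 0\le k<\lambda_i,\ \lambda_i-k\text{ odd}\},$$ $$N_{(2)}=\{\zeta_{i,j,k}: i<j,\ j\ne i^*,\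 0\le k<\min\{\lambda_i,\lambda_j\}\},\qquad N_2=\mathrm{Span}(N_{(2)}),$$ $$N_{(2)}^-=\{\zeta_{i,i+1,\lambda_{i+1}-1}: 1\le i<N,\ i=i^*,\ i+1=(i+1)^*,\ \lambda_{i-1}>\lambda_i\ge\lambda_{i+1}>\lambda_{i+2}\},\qquad N_2^+=\mathrm{Span}(N_{(2)}\setminus N_{(2)}^-),$$ where $\lambda_0=\infty$ and $\lambda_{N+1}=0$, and $$\mathfrak N_0=\mathrm{Span}\big(\{\xi_i^{i,\lambda_i-1-k}: i=i^*,\ 0\le k<\lambda_i,\ \lambda_i-k\text{ even}\}\cup\{\xi_i^{i,\lambda_i-1-k}+\xi_{i^*}^{i^*,\lambda_i-1-k}: i\ne i^*,\ 0\le k<\lambda_i,\ \lambda_i-k\text{ even}\}\big),$$ $$\mathfrak N_1=\mathrm{Span}\{\xi_i^{i,\lambda_i-1-k}-\xi_{i^*}^{i^*,\lambda_i-1-k}: i\ne i^*,\ 0\le k<\lambda_i,\ \lambda_i-k\text{ odd}\}.$$ Theorem. An adapted basis for $e$ exists, and for every adapted basis $$[\mathfrak g^e,\mathfrak g^e]=N_1\oplus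 N_2^+\oplus\mathfrak N_1\oplus(\mathfrak N_0\cap[N_2,N_2]);$$ moreover $N_1\subseteq[\mathfrak g^e,\mathfrak g^e]$ and $N_2\cap[\mathfrak g^e,\mathfrak g^e]=N_2^+$. -/

import Mathlib

noncomputable section

namespace OspCentralizer

open Module

variable {V : Type*} [AddCommGroup V] [Module ℂ V]
variable (𝒱 : ZMod 2 → Submodule ℂ V)

/-- The sign `(-1) ^ (p q)` attached to a pair of parities. -/
def sgn (p q : ZMod 2) : ℂ := (-1) ^ (p.val * q.val)

/-- Endomorphisms of the superspace `V` that are homogeneous of parity `p`. -/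
def glPart (p : ZMod 2) : Submodule ℂ (End ℂ V) where
  carrier := {x | ∀ a, ∀ u ∈ 𝒱 a, x u ∈ 𝒱 (a + p)}
  add_mem' hx hy a u hu := add_mem (hx a u hu) (hy a u hu)
  zero_mem' a _ _ := (𝒱 (a + p)).zero_mem
  smul_mem' c _ hx a u hu := (𝒱 (a + p)).smul_mem c (hx a u hu)

/-- The projection of `V` onto its homogeneous part of parity `a`. -/
def proj [DirectSum.Decomposition 𝒱] (a : ZMod 2) : End ℂ V :=
  (𝒱 a).subtype ∘ₗ DirectSum.component ℂ (ZMod 2) (fun i => 𝒱 i) a ∘ₗ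
    (DirectSum.decomposeLinearEquiv 𝒱).toLinearMap

/-- The homogeneous component of parity `p` of an endomorphism. -/
def part [DirectSum.Decomposition 𝒱] (p : ZMod 2) (x : End ℂ V) : End ℂ V :=
  ∑ a : ZMod 2, proj 𝒱 (a + p) * x * proj 𝒱 a

/-- The Lie superbracket of `gl(V)`: the bilinear map with `[x, y] = x y - (-1)^(p q) y x` for `x`
of parity `p` and `y` of parity `q`. -/
def superBracket [DirectSum.Decomposition 𝒱] : End ℂ V →ₗ[ℂ] End ℂ V →ₗ[ℂ] End ℂ V :=
  LinearMap.mk₂ ℂ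
    (fun x y => ∑ p : ZMod 2, ∑ q : ZMod 2,
      (part 𝒱 p x * part 𝒱 q y - sgn p q • (part 𝒱 q y * part 𝒱 p x)))
    (by
      intro x x' y
      simp only [part, ← Finset.sum_add_distrib, mul_add, add_mul]
      refine Finset.sum_congr rfl fun p _ => Finset.sum_congr rfl fun q _ => ?_
      simp only [Finset.sum_add_distrib, mul_add, add_mul, smul_add]
      abel)
    (by
      intro c x y
      rw [Finset.smul_sum]
      refine Finset.sum_congr rfl fun p _ => ?_
      rw [Finset.smul_sum]
      refine Finset.sum_congr rfl fun q _ => ?_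
      simp only [part, mul_smul_comm, smul_mul_assoc, ← Finset.smul_sum, smul_sub]
      rw [smul_comm c])
    (by
      intro x y y'
      simp only [part, ← Finset.sum_add_distrib, mul_add, add_mul]
      refine Finset.sum_congr rfl fun p _ => Finset.sum_congr rfl fun q _ => ?_
      simp only [Finset.sum_add_distrib, mul_add, add_mul, smul_add]
      abel)
    (by
      intro c x y
      rw [Finset.smul_sum]
      refine Finset.sum_congr rfl fun p _ => ?_
      rw [Finset.smul_sum]
      refine Finset.sum_congr rfl fun q _ => ?_
      simp only [part, mul_smul_comm, smul_mul_assoc, ← Finset.smul_sum, smul_sub]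
      rw [smul_comm c])

/-- `[A, B]`: the span of all superbrackets of an element of `A` with an element of `B`. -/
def bracketSpan [DirectSum.Decomposition 𝒱] (A B : Submodule ℂ (End ℂ V)) :
    Submodule ℂ (End ℂ V) :=
  Submodule.span ℂ {z | ∃ x ∈ A, ∃ y ∈ B, z = superBracket 𝒱 x y}

/-- Non-degenerate even supersymmetric bilinear forms on the superspace `V`. -/
structure IsSuperForm (β : LinearMap.BilinForm ℂ V) : Prop where
  even : ∀ a b, a ≠ b → ∀ u ∈ 𝒱 a, ∀ w ∈ 𝒱 b, β u w = 0
  supersymmetric : ∀ a b, ∀ u ∈ 𝒱 a, ∀ w ∈ 𝒱 b, β u w = sgn a b * β w u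
  nondegenerate : β.Nondegenerate

/-- The part of parity `p` of `osp(V)`. -/
def ospPart (β : LinearMap.BilinForm ℂ V) (p : ZMod 2) : Submodule ℂ (End ℂ V) where
  carrier := {x | x ∈ glPart 𝒱 p ∧ ∀ a, ∀ u ∈ 𝒱 a, ∀ w, β (x u) w + sgn p a * β u (x w) = 0}
  add_mem' := by
    rintro x y ⟨hx, hx'⟩ ⟨hy, hy'⟩
    refine ⟨add_mem hx hy, fun a u hu w => ?_⟩
    have h1 := hx' a u hu w
    have h2 := hy' a u hu w
    simp only [LinearMap.add_apply, map_add]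
    linear_combination h1 + h2
  zero_mem' := ⟨zero_mem _, fun a u _ w => by simp⟩
  smul_mem' := by
    rintro c x ⟨hx, hx'⟩
    refine ⟨Submodule.smul_mem _ c hx, fun a u hu w => ?_⟩
    have h1 := hx' a u hu w
    simp only [LinearMap.smul_apply, map_smul, smul_eq_mul]
    linear_combination c * h1

/-- The orthosymplectic Lie superalgebra `osp(V)`, as a subspace of `gl(V)`. -/
def osp (β : LinearMap.BilinForm ℂ V) : Submodule ℂ (End ℂ V) :=
  ospPart 𝒱 β 0 ⊔ ospPart 𝒱 β 1

/-- The centralizer of `e` in `osp(V)`. -/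
def centralizer [DirectSum.Decomposition 𝒱] (β : LinearMap.BilinForm ℂ V) (e : End ℂ V) :
    Submodule ℂ (End ℂ V) :=
  osp 𝒱 β ⊓ LinearMap.ker (superBracket 𝒱 e)

/-- An adapted Jordan basis of a nilpotent even element `e` of `osp(V)`: Jordan chains
`v i, e (v i), …, e ^ (lam i - 1) (v i)` with homogeneous generators `v i` of parity `par i`,
indexed (from `0`) by weakly decreasing length with even chains before odd chains of the same
length, on which the form pairs the chain of `i` exactly with the chain of `star i`. -/
structure AdaptedBasis (β : LinearMap.BilinForm ℂ V) (e : End ℂ V) where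
  /-- the number of Jordan chains -/
  N : ℕ
  /-- the lengths of the chains -/
  lam : Fin N → ℕ
  lam_pos : ∀ i, 0 < lam i
  lam_antitone : Antitone lam
  /-- the parities of the chains -/
  par : Fin N → ZMod 2
  par_order : ∀ i j, lam i = lam j → par i = 0 → par j = 1 → i < j
  /-- the generators of the chains -/
  v : Fin N → V
  v_mem : ∀ i, v i ∈ 𝒱 (par i)
  pow_lam : ∀ i, (e ^ lam i) (v i) = 0
  /-- the basis of `V` formed by the chains -/
  basis : Basis (Σ i : Fin N, Fin (lam i)) ℂ V
  basis_apply : ∀ i (a : Fin (lam i)), basis ⟨i, a⟩ = (e ^ (a : ℕ)) (v i)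
  /-- the involution `i ↦ i*` -/
  star : Fin N → Fin N
  star_star : ∀ i, star (star i) = i
  star_near : ∀ i, (star i : ℕ) ≤ i + 1 ∧ (i : ℕ) ≤ star i + 1
  lam_star : ∀ i, lam (star i) = lam i
  par_star : ∀ i, par (star i) = par i
  star_eq_iff : ∀ i, star i = i ↔ (par i = 0 ∧ Odd (lam i)) ∨ (par i = 1 ∧ Even (lam i))
  /-- the signs of the form on the chains -/
  θ : Fin N → ℂ
  θ_eq : ∀ i, θ i = 1 ∨ θ i = -1
  form_eq : ∀ i j, ∀ a < lam i, ∀ b < lam j, β ((e ^ a) (v i)) ((e ^ b) (v j)) =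
    if j = star i ∧ a + b + 1 = lam i then (-1) ^ a * θ i else 0

namespace AdaptedBasis

variable {𝒱} {β : LinearMap.BilinForm ℂ V} {e : End ℂ V} (D : AdaptedBasis 𝒱 β e)

/-- `ξ_i^{j,k}`: the map that sends `e ^ a (v i)` to `e ^ (a + k) (v j)` for every `a` and kills
all other chains. For `lam j - lam i ≤ k` it is the map commuting with `e` that sends `v i` to
`e ^ k (v j)` and the other generators to zero. -/
def xi (i j : Fin D.N) (k : ℕ) : End ℂ V :=
  D.basis.constr ℂ fun s => if s.1 = i then (e ^ ((s.2 : ℕ) + k)) (D.v j) else 0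

/-- `ε_{i,j,k} = (-1) ^ (lam j - k - x i) θ_j θ_i`, where `x` is the parity of `ξ_i^{j,k}`
(with the signs in the exponent made positive). -/
def eps (i j : Fin D.N) (k : ℕ) : ℂ :=
  (-1) ^ (D.lam j + k + (D.par i + D.par j).val * (D.par i).val) * D.θ j * D.θ i

/-- `ξ_i^{j, lam j - 1 - k} + ε_{i,j,k} ξ_{j*}^{i*, lam i - 1 - k}`. -/
def zeta (i j : Fin D.N) (k : ℕ) : End ℂ V :=
  D.xi i j (D.lam j - 1 - k) + D.eps i j k • D.xi (D.star j) (D.star i) (D.lam i - 1 - k)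

/-- `N_1`. -/
def N₁ : Submodule ℂ (End ℂ V) :=
  Submodule.span ℂ {x | ∃ i, ∃ k < D.lam i, i ≠ D.star i ∧ Odd (D.lam i - k) ∧
    x = D.xi i (D.star i) (D.lam i - 1 - k)}

/-- The basis of `N_2`. -/
def N₂Set : Set (End ℂ V) :=
  {x | ∃ i j, ∃ k < min (D.lam i) (D.lam j), i < j ∧ j ≠ D.star i ∧ x = D.zeta i j k}

/-- `N_2`. -/
def N₂ : Submodule ℂ (End ℂ V) := Submodule.span ℂ D.N₂Set

/-- The basis of `N_2^-`; the conditions on the neighbours `i - 1` and `i + 2` are void when there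
is no such index (that is, `lam 0 = ∞` and `lam (N + 1) = 0` in one-based indexing). -/
def N₂MinusSet : Set (End ℂ V) :=
  {x | ∃ i j : Fin D.N, (j : ℕ) = i + 1 ∧ i = D.star i ∧ j = D.star j ∧
    (∀ l : Fin D.N, (l : ℕ) + 1 = i → D.lam i < D.lam l) ∧
    (∀ l : Fin D.N, (l : ℕ) = j + 1 → D.lam l < D.lam j) ∧ x = D.zeta i j (D.lam j - 1)}

/-- `N_2^+`. -/
def N₂Plus : Submodule ℂ (End ℂ V) := Submodule.span ℂ (D.N₂Set \ D.N₂MinusSet)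

/-- `𝔑_0`. -/
def 𝔑₀ : Submodule ℂ (End ℂ V) :=
  Submodule.span ℂ
    ({x | ∃ i, ∃ k < D.lam i, i = D.star i ∧ Even (D.lam i - k) ∧
        x = D.xi i i (D.lam i - 1 - k)} ∪
      {x | ∃ i, ∃ k < D.lam i, i ≠ D.star i ∧ Even (D.lam i - k) ∧
        x = D.xi i i (D.lam i - 1 - k) + D.xi (D.star i) (D.star i) (D.lam i - 1 - k)})

/-- `𝔑_1`. -/
def 𝔑₁ : Submodule ℂ (End ℂ V) :=
  Submodule.span ℂ {x | ∃ i, ∃ k < D.lam i, i ≠ D.star i ∧ Odd (D.lam i - k) ∧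
    x = D.xi i i (D.lam i - 1 - k) - D.xi (D.star i) (D.star i) (D.lam i - 1 - k)}

end AdaptedBasis

end OspCentralizer

end

/-! The negative supertranspose `sigma` is an involutive automorphism of the Lie superalgebra gl(V)
fixing osp(V) pointwise, and it sends each ξ_i^{j,r} commuting with e to a sign times a ξ from j* to
i*. Hence g^e is spanned by the symmetrizations `sxi i j r` = ξ + σξ, and `superBracket_symm`
reduces their brackets to products of ξ's (`superBracket_sxi`).

Upper bound (`derived_le`): the bracket of two `sxi` has a diagonal part only if the index pairs are
reverse to each other, possibly after applying σ. Off-diagonal terms lie in N_1 + N_2. Diagonal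
terms of even exponent lie in 𝔑_1; those of odd exponent lie in 𝔑_0 and come only from brackets of
N_2 with itself.

Lower bound: bracketing with the diagonal elements `sxi i i 0` and `sxi i i 1` produces N_1 and most
of N_2, while 𝔑_1 comes from the chains i and i* paired with each other. If i and j are both fixed
by the involution and the exponent is 0, the ζ factors through a third chain whose length lies
between theirs. Such a chain is missing exactly for the basis of N_2^- (`zeta_mem_derived`).

That N_2^- really drops out is seen on V/eV: `lead i j` is a matrix entry of the induced map, and on
a product of two `sxi` it is a sum over intermediate chains n in which every term vanishes
(`IsMinusPair.lead_mul_sxi`). Directness holds because the summands involve disjoint sets of ξ's.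

Existence: a family of chains in normal form that does not span has a nonzero orthogonal complement.
Its longest chains carry the form (u, e^(l-1) w), symmetric or skew on each parity, which yields a
self-paired chain or a dual isotropic pair to split off (`exists_larger`). Sorting the chains gives
an adapted basis. -/

noncomputable section

namespace OspCentralizer

open Module

/-! ### Homogeneous components, the superbracket and the negative supertranspose. -/

section Super

variable {V : Type*} [AddCommGroup V] [Module ℂ V]
variable {𝒱 : ZMod 2 → Submodule ℂ V}

theorem zmod_two_cases (p : ZMod 2) : p = 0 ∨ p = 1 := by
  revert p; decide

theorem zmod_two_add_self (p : ZMod 2) : p + p = 0 := by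
  revert p; decide

theorem zmod_two_add_add_self (p q : ZMod 2) : p + q + q = p := by
  rw [add_assoc, zmod_two_add_self, add_zero]

@[simp] theorem sgn_zero_left (q : ZMod 2) : sgn 0 q = 1 := by simp [sgn]

@[simp] theorem sgn_zero_right (q : ZMod 2) : sgn q 0 = 1 := by simp [sgn]

@[simp] theorem sgn_one_one : sgn 1 1 = -1 := by simp [sgn, ZMod.val_one]

theorem sgn_comm (p q : ZMod 2) : sgn p q = sgn q p := by simp [sgn, mul_comm]

theorem sgn_add_right (p q r : ZMod 2) : sgn p (q + r) = sgn p q * sgn p r := by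
  rcases zmod_two_cases p with rfl | rfl <;> rcases zmod_two_cases q with rfl | rfl <;>
    rcases zmod_two_cases r with rfl | rfl <;> simp [zmod_two_add_self]

theorem sgn_add_left (p q r : ZMod 2) : sgn (p + q) r = sgn p r * sgn q r := by
  rw [sgn_comm, sgn_add_right, sgn_comm r p, sgn_comm r q]

theorem sgn_mul_self (p q : ZMod 2) : sgn p q * sgn p q = 1 := by
  rcases zmod_two_cases p with rfl | rfl <;> rcases zmod_two_cases q with rfl | rfl <;> simp

theorem sgn_self (p : ZMod 2) : sgn p p = (-1) ^ p.val := by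
  rcases zmod_two_cases p with rfl | rfl <;> simp [ZMod.val_one]

theorem glPart_mul {p q : ZMod 2} {x y : End ℂ V} (hx : x ∈ glPart 𝒱 p) (hy : y ∈ glPart 𝒱 q) :
    x * y ∈ glPart 𝒱 (p + q) := fun a u hu => by
  have := hx _ _ (hy a u hu)
  rwa [add_assoc, add_comm q p] at this

theorem pow_mem_glPart {e : End ℂ V} (he : e ∈ glPart 𝒱 0) (n : ℕ) : e ^ n ∈ glPart 𝒱 0 := by
  induction n with
  | zero => intro a u hu; simpa using hu
  | succ n ih => rw [pow_succ]; simpa using glPart_mul ih he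

theorem ospPart_le_osp (β : LinearMap.BilinForm ℂ V) (p : ZMod 2) : ospPart 𝒱 β p ≤ osp 𝒱 β := by
  rcases zmod_two_cases p with rfl | rfl
  · exact le_sup_left
  · exact le_sup_right

variable [DirectSum.Decomposition 𝒱]

theorem proj_apply (a : ZMod 2) (u : V) : proj 𝒱 a u = (DirectSum.decompose 𝒱 u a : V) := rfl

theorem proj_mem (a : ZMod 2) (u : V) : proj 𝒱 a u ∈ 𝒱 a := by
  rw [proj_apply]; exact SetLike.coe_mem _

theorem proj_of_mem {a : ZMod 2} {u : V} (hu : u ∈ 𝒱 a) : proj 𝒱 a u = u := by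
  rw [proj_apply, DirectSum.decompose_of_mem_same _ hu]

theorem proj_of_mem_ne {a b : ZMod 2} {u : V} (hu : u ∈ 𝒱 a) (h : a ≠ b) : proj 𝒱 b u = 0 := by
  rw [proj_apply, DirectSum.decompose_of_mem_ne _ hu h]

theorem proj_of_mem_ite {a : ZMod 2} {u : V} (hu : u ∈ 𝒱 a) (b : ZMod 2) :
    proj 𝒱 b u = if b = a then u else 0 := by
  split_ifs with h
  · subst h; exact proj_of_mem hu
  · exact proj_of_mem_ne hu (Ne.symm h)

variable (𝒱) in
theorem sum_proj (u : V) : ∑ a, proj 𝒱 a u = u := by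
  classical
  conv_rhs => rw [← DirectSum.sum_support_decompose 𝒱 u]
  refine (Finset.sum_subset (Finset.subset_univ _) ?_).symm
  intro a _ ha
  rw [proj_apply]
  simpa using ha

variable (𝒱) in
theorem end_ext_homogeneous {W : Type*} [AddCommGroup W] [Module ℂ W] {x y : V →ₗ[ℂ] W}
    (h : ∀ a, ∀ u ∈ 𝒱 a, x u = y u) : x = y := by
  ext u
  rw [← sum_proj 𝒱 u, map_sum, map_sum]
  exact Finset.sum_congr rfl fun a _ => h a _ (proj_mem a u)

theorem part_apply_of_mem (p : ZMod 2) (x : End ℂ V) {a : ZMod 2} {u : V} (hu : u ∈ 𝒱 a) :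
    part 𝒱 p x u = proj 𝒱 (a + p) (x u) := by
  simp only [part, LinearMap.sum_apply, Module.End.mul_apply]
  rw [Finset.sum_eq_single a]
  · rw [proj_of_mem hu]
  · intro b _ hb
    rw [proj_of_mem_ne hu hb.symm, map_zero, map_zero]
  · simp

theorem part_mem (p : ZMod 2) (x : End ℂ V) : part 𝒱 p x ∈ glPart 𝒱 p := fun a u hu => by
  rw [part_apply_of_mem p x hu]; exact proj_mem _ _

variable (𝒱) in
theorem sum_part (x : End ℂ V) : ∑ p, part 𝒱 p x = x := by
  refine end_ext_homogeneous 𝒱 fun a u hu => ?_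
  rw [LinearMap.sum_apply]
  simp only [part_apply_of_mem _ x hu]
  conv_rhs => rw [← sum_proj 𝒱 (x u)]
  exact Fintype.sum_equiv (Equiv.addLeft a) _ _ fun _ => rfl

theorem part_of_mem {p : ZMod 2} {x : End ℂ V} (hx : x ∈ glPart 𝒱 p) : part 𝒱 p x = x :=
  end_ext_homogeneous 𝒱 fun a u hu => by
    rw [part_apply_of_mem p x hu, proj_of_mem (hx a u hu)]

theorem part_of_mem_ne {p q : ZMod 2} {x : End ℂ V} (hx : x ∈ glPart 𝒱 p) (h : p ≠ q) :
    part 𝒱 q x = 0 :=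
  end_ext_homogeneous 𝒱 fun a u hu => by
    rw [part_apply_of_mem q x hu, proj_of_mem_ne (hx a u hu) (by simpa using h)]; rfl

theorem superBracket_apply (x y : End ℂ V) : superBracket 𝒱 x y =
    ∑ p : ZMod 2, ∑ q : ZMod 2,
      (part 𝒱 p x * part 𝒱 q y - sgn p q • (part 𝒱 q y * part 𝒱 p x)) := rfl

theorem superBracket_of_mem {p q : ZMod 2} {x y : End ℂ V} (hx : x ∈ glPart 𝒱 p)
    (hy : y ∈ glPart 𝒱 q) : superBracket 𝒱 x y = x * y - sgn p q • (y * x) := by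
  rw [superBracket_apply, Finset.sum_eq_single p]
  · rw [Finset.sum_eq_single q]
    · rw [part_of_mem hx, part_of_mem hy]
    · intro r _ hr
      rw [part_of_mem_ne hy hr.symm]; simp
    · simp
  · intro r _ hr
    rw [part_of_mem_ne hx hr.symm]; simp
  · simp

theorem superBracket_even {e : End ℂ V} (he : e ∈ glPart 𝒱 0) (x : End ℂ V) :
    superBracket 𝒱 e x = e * x - x * e := by
  conv_lhs => rw [← sum_part 𝒱 x]
  rw [map_sum]
  have : ∀ p ∈ (Finset.univ : Finset (ZMod 2)), superBracket 𝒱 e (part 𝒱 p x) =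
      e * part 𝒱 p x - part 𝒱 p x * e := fun p _ => by
    rw [superBracket_of_mem he (part_mem p x)]; simp
  rw [Finset.sum_congr rfl this, Finset.sum_sub_distrib, ← Finset.mul_sum, ← Finset.sum_mul,
    sum_part]

variable (𝒱) in
/-- The homogeneous component of an endomorphism, as a linear map. -/
def partLinear (p : ZMod 2) : End ℂ V →ₗ[ℂ] End ℂ V :=
  ∑ a, LinearMap.mulLeft ℂ (proj 𝒱 (a + p)) ∘ₗ LinearMap.mulRight ℂ (proj 𝒱 a)

theorem partLinear_apply (p : ZMod 2) (x : End ℂ V) : partLinear 𝒱 p x = part 𝒱 p x := by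
  simp [partLinear, part, mul_assoc]

variable {β : LinearMap.BilinForm ℂ V}

theorem IsSuperForm.ext (hβ : IsSuperForm 𝒱 β) {u u' : V} (h : ∀ b, ∀ w ∈ 𝒱 b, β u w = β u' w) :
    u = u' := by
  have h2 : β u = β u' := end_ext_homogeneous 𝒱 h
  have := hβ.nondegenerate.1 (u - u') (fun w => by rw [map_sub, h2]; simp)
  exact sub_eq_zero.mp this

variable [FiniteDimensional ℂ V]

/-- The adjoint of an endomorphism with respect to a non-degenerate form. -/
def adj (hβ : IsSuperForm 𝒱 β) : End ℂ V →ₗ[ℂ] End ℂ V :=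
  (β.toDual hβ.nondegenerate).symm.conj.toLinearMap ∘ₗ Module.Dual.transpose

omit [DirectSum.Decomposition 𝒱] in
theorem adj_spec (hβ : IsSuperForm 𝒱 β) (x : End ℂ V) (u w : V) :
    β (adj hβ x u) w = β u (x w) := by
  simp [adj, LinearEquiv.conj_apply, LinearMap.BilinForm.apply_toDual_symm_apply,
    Module.Dual.transpose_apply, LinearMap.BilinForm.toDual_def]

/-- The negative supertranspose, an involutive automorphism of the Lie superalgebra `gl(V)` whose
fixed points form `osp(V)`. -/
def sigma (hβ : IsSuperForm 𝒱 β) : End ℂ V →ₗ[ℂ] End ℂ V :=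
  -∑ p, ∑ a, sgn p a • (LinearMap.mulRight ℂ (proj 𝒱 a) ∘ₗ adj hβ ∘ₗ partLinear 𝒱 p)

theorem sigma_spec (hβ : IsSuperForm 𝒱 β) {p a : ZMod 2} {x : End ℂ V} (hx : x ∈ glPart 𝒱 p)
    {u : V} (hu : u ∈ 𝒱 a) (w : V) : β (sigma hβ x u) w = -sgn p a * β u (x w) := by
  have key : sigma hβ x u = -(sgn p a • adj hβ x u) := by
    simp only [sigma, LinearMap.neg_apply, LinearMap.sum_apply, LinearMap.smul_apply,
      LinearMap.comp_apply, partLinear_apply, LinearMap.mulRight_apply, Module.End.mul_apply]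
    congr 1
    rw [Finset.sum_eq_single p]
    · rw [Finset.sum_eq_single a]
      · rw [part_of_mem hx, proj_of_mem hu]
      · intro b _ hb
        rw [proj_of_mem_ne hu hb.symm]; simp
      · simp
    · intro q _ hq
      rw [part_of_mem_ne hx hq.symm]; simp
    · simp
  rw [key]
  simp [adj_spec]

theorem sigma_mem (hβ : IsSuperForm 𝒱 β) {p : ZMod 2} {x : End ℂ V} (hx : x ∈ glPart 𝒱 p) :
    sigma hβ x ∈ glPart 𝒱 p := by
  intro a u hu
  have : proj 𝒱 (a + p) (sigma hβ x u) = sigma hβ x u := by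
    refine hβ.ext fun b w hw => ?_
    by_cases h : b = a + p
    · subst h
      conv_rhs => rw [← sum_proj 𝒱 (sigma hβ x u)]
      rw [map_sum, LinearMap.sum_apply, Finset.sum_eq_single (a + p)]
      · intro c _ hc
        exact hβ.even _ _ hc _ (proj_mem _ _) _ hw
      · simp
    · rw [hβ.even _ _ (Ne.symm h) _ (proj_mem _ _) _ hw, sigma_spec hβ hx hu,
        hβ.even a (b + p) _ u hu _ (hx b w hw), mul_zero]
      intro h'
      exact h (by rw [h', zmod_two_add_add_self])
  rw [← this]
  exact proj_mem _ _

theorem eq_sigma (hβ : IsSuperForm 𝒱 β) {p : ZMod 2} {x y : End ℂ V} (hx : x ∈ glPart 𝒱 p)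
    (h : ∀ a, ∀ u ∈ 𝒱 a, ∀ b, ∀ w ∈ 𝒱 b, β (y u) w = -sgn p a * β u (x w)) : sigma hβ x = y :=
  end_ext_homogeneous 𝒱 fun a u hu => hβ.ext fun b w hw => by
    rw [sigma_spec hβ hx hu, h a u hu b w hw]

theorem sigma_sigma_of_mem (hβ : IsSuperForm 𝒱 β) {p : ZMod 2} {x : End ℂ V}
    (hx : x ∈ glPart 𝒱 p) : sigma hβ (sigma hβ x) = x := by
  refine eq_sigma hβ (sigma_mem hβ hx) fun a u hu b w hw => ?_
  by_cases h : b = a + p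
  · subst h
    rw [hβ.supersymmetric _ _ u hu _ (sigma_mem hβ hx _ w hw), sigma_spec hβ hx hw,
      hβ.supersymmetric _ _ w hw _ (hx a u hu)]
    rcases zmod_two_cases p with rfl | rfl <;> rcases zmod_two_cases a with rfl | rfl <;>
      simp [zmod_two_add_self]
  · rw [hβ.even _ _ (Ne.symm h) _ (hx a u hu) _ hw,
      hβ.even a (b + p) _ u hu _ (sigma_mem hβ hx b w hw), mul_zero]
    intro h'
    exact h (by rw [h', zmod_two_add_add_self])

theorem sigma_sigma (hβ : IsSuperForm 𝒱 β) (x : End ℂ V) : sigma hβ (sigma hβ x) = x := by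
  rw [← sum_part 𝒱 x, map_sum, map_sum]
  exact Finset.sum_congr rfl fun p _ => sigma_sigma_of_mem hβ (part_mem p x)

/-- Moving x and then y across the form reverses the product. The extra minus sign makes σ respect
the superbracket rather than the product. -/
theorem sigma_mul (hβ : IsSuperForm 𝒱 β) {p q : ZMod 2} {x y : End ℂ V} (hx : x ∈ glPart 𝒱 p)
    (hy : y ∈ glPart 𝒱 q) : sigma hβ (x * y) = -sgn p q • (sigma hβ y * sigma hβ x) := by
  refine eq_sigma hβ (glPart_mul hx hy) fun a u hu b w _ => ?_
  simp only [LinearMap.smul_apply, Module.End.mul_apply, map_smul, smul_eq_mul]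
  rw [sigma_spec hβ hy (sigma_mem hβ hx a u hu), sigma_spec hβ hx hu, sgn_add_left, sgn_add_right,
    sgn_comm q p]
  linear_combination (- sgn q a * sgn p a * β u (x (y w))) * sgn_mul_self p q

theorem sigma_superBracket_of_mem (hβ : IsSuperForm 𝒱 β) {p q : ZMod 2} {x y : End ℂ V}
    (hx : x ∈ glPart 𝒱 p) (hy : y ∈ glPart 𝒱 q) :
    sigma hβ (superBracket 𝒱 x y) = superBracket 𝒱 (sigma hβ x) (sigma hβ y) := by
  rw [superBracket_of_mem hx hy, superBracket_of_mem (sigma_mem hβ hx) (sigma_mem hβ hy), map_sub,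
    map_smul, sigma_mul hβ hx hy, sigma_mul hβ hy hx, smul_smul, sgn_comm q p, mul_neg,
    sgn_mul_self]
  simp only [neg_smul, one_smul, sub_neg_eq_add]
  abel

theorem mem_ospPart_iff (hβ : IsSuperForm 𝒱 β) {p : ZMod 2} {x : End ℂ V} :
    x ∈ ospPart 𝒱 β p ↔ x ∈ glPart 𝒱 p ∧ sigma hβ x = x := by
  constructor
  · rintro ⟨hx, h⟩
    refine ⟨hx, eq_sigma hβ hx fun a u hu b w _ => ?_⟩
    linear_combination h a u hu w
  · rintro ⟨hx, h⟩
    refine ⟨hx, fun a u hu w => ?_⟩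
    have := sigma_spec hβ hx hu w
    rw [h] at this
    linear_combination this

theorem sigma_of_mem_osp (hβ : IsSuperForm 𝒱 β) {x : End ℂ V} (hx : x ∈ osp 𝒱 β) :
    sigma hβ x = x := by
  obtain ⟨y, hy, z, hz, rfl⟩ := Submodule.mem_sup.mp hx
  rw [map_add, ((mem_ospPart_iff hβ).mp hy).2, ((mem_ospPart_iff hβ).mp hz).2]

/-- The symmetrization `x + σ x`, which maps `gl(V)` onto `osp(V)`. -/
def symm (hβ : IsSuperForm 𝒱 β) : End ℂ V →ₗ[ℂ] End ℂ V := LinearMap.id + sigma hβ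

theorem symm_apply (hβ : IsSuperForm 𝒱 β) (x : End ℂ V) : symm hβ x = x + sigma hβ x := rfl

theorem symm_sigma (hβ : IsSuperForm 𝒱 β) (x : End ℂ V) :
    symm hβ (sigma hβ x) = symm hβ x := by
  rw [symm_apply, symm_apply, sigma_sigma, add_comm]

theorem symm_mem_osp (hβ : IsSuperForm 𝒱 β) {p : ZMod 2} {x : End ℂ V} (hx : x ∈ glPart 𝒱 p) :
    symm hβ x ∈ osp 𝒱 β :=
  ospPart_le_osp β p ((mem_ospPart_iff hβ).mpr ⟨add_mem hx (sigma_mem hβ hx), by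
    rw [symm_apply, map_add, sigma_sigma, add_comm]⟩)

/-- Of the four terms of the expanded bracket, two are the σ-images of the other two. All brackets
in g^e are computed this way. -/
theorem superBracket_symm (hβ : IsSuperForm 𝒱 β) {p q : ZMod 2} {x y : End ℂ V}
    (hx : x ∈ glPart 𝒱 p) (hy : y ∈ glPart 𝒱 q) :
    superBracket 𝒱 (symm hβ x) (symm hβ y) =
      symm hβ (superBracket 𝒱 x y) + symm hβ (superBracket 𝒱 x (sigma hβ y)) := by
  simp only [symm_apply, map_add, LinearMap.add_apply, sigma_superBracket_of_mem hβ hx hy,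
    sigma_superBracket_of_mem hβ hx (sigma_mem hβ hy), sigma_sigma]
  abel

end Super

/-! ### The endomorphisms ξ, their coordinates, and the action of σ on them. -/

section Basics

namespace AdaptedBasis

variable {V : Type*} [AddCommGroup V] [Module ℂ V] {𝒱 : ZMod 2 → Submodule ℂ V}
variable {β : LinearMap.BilinForm ℂ V} {e : End ℂ V} (D : AdaptedBasis 𝒱 β e)

theorem pow_apply_eq_zero {i : Fin D.N} {a : ℕ} (h : D.lam i ≤ a) : (e ^ a) (D.v i) = 0 := by
  obtain ⟨c, rfl⟩ := Nat.exists_eq_add_of_le' h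
  rw [pow_add, Module.End.mul_apply, D.pow_lam, map_zero]

/-- The coordinate functional of `e ^ r (v j)`; it is zero if `r` is at least `lam j`. -/
def coord (j : Fin D.N) (r : ℕ) : V →ₗ[ℂ] ℂ :=
  if h : r < D.lam j then D.basis.coord ⟨j, r, h⟩ else 0

theorem coord_of_le {j : Fin D.N} {r : ℕ} (h : D.lam j ≤ r) : D.coord j r = 0 :=
  dif_neg (by omega)

theorem coord_pow (j l : Fin D.N) (r a : ℕ) :
    D.coord j r ((e ^ a) (D.v l)) = if l = j ∧ a = r ∧ r < D.lam j then 1 else 0 := by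
  by_cases hr : r < D.lam j
  · rw [coord, dif_pos hr]
    by_cases ha : a < D.lam l
    · rw [← D.basis_apply l ⟨a, ha⟩, Basis.coord_apply, Basis.repr_self, Finsupp.single_apply]
      congr 1
      rw [Sigma.mk.injEq, eq_iff_iff]
      constructor
      · rintro ⟨rfl, h⟩
        have := Fin.mk.inj_iff.mp (eq_of_heq h)
        exact ⟨rfl, this, hr⟩
      · rintro ⟨rfl, rfl, _⟩
        exact ⟨rfl, HEq.rfl⟩
    · rw [D.pow_apply_eq_zero (by omega), map_zero, if_neg]
      rintro ⟨rfl, rfl, h⟩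
      omega
  · rw [D.coord_of_le (by omega), if_neg (by tauto)]
    rfl

theorem sum_coord (u : V) :
    ∑ j, ∑ r ∈ Finset.range (D.lam j), D.coord j r u • (e ^ r) (D.v j) = u := by
  conv_rhs => rw [← D.basis.sum_repr u]
  rw [Fintype.sum_sigma]
  refine Finset.sum_congr rfl fun j _ => ?_
  rw [Finset.sum_range]
  refine Finset.sum_congr rfl fun r _ => ?_
  rw [D.basis_apply, coord, dif_pos r.2, Basis.coord_apply]

theorem end_ext {x y : End ℂ V} (h : ∀ i, ∀ a < D.lam i, x ((e ^ a) (D.v i)) = y ((e ^ a) (D.v i))) :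
    x = y :=
  D.basis.ext fun ⟨i, a⟩ => by rw [D.basis_apply]; exact h i a a.2

theorem pow_apply_of_commute {x : End ℂ V} (hx : Commute e x) (a : ℕ) (u : V) :
    x ((e ^ a) u) = (e ^ a) (x u) := by
  have := (hx.pow_left a).eq
  rw [← Module.End.mul_apply, ← this, Module.End.mul_apply]

theorem xi_apply_of_lt {i j l : Fin D.N} {k a : ℕ} (ha : a < D.lam l) :
    D.xi i j k ((e ^ a) (D.v l)) = if l = i then (e ^ (a + k)) (D.v j) else 0 := by
  rw [← D.basis_apply l ⟨a, ha⟩, xi, Basis.constr_basis]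

/-- The inequality says that e^(a+k) v_j is already zero once e^a v_i is, so no bound on a is
needed. This is what makes ξ commute with e. -/
theorem xi_apply {i j : Fin D.N} {k : ℕ} (h : D.lam j ≤ D.lam i + k) (l : Fin D.N) (a : ℕ) :
    D.xi i j k ((e ^ a) (D.v l)) = if l = i then (e ^ (a + k)) (D.v j) else 0 := by
  by_cases ha : a < D.lam l
  · exact D.xi_apply_of_lt ha
  · rw [D.pow_apply_eq_zero (by omega), map_zero]
    split_ifs with hl
    · subst hl
      rw [D.pow_apply_eq_zero (by omega)]
    · rfl

theorem xi_apply_v (i j : Fin D.N) (k : ℕ) (l : Fin D.N) :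
    D.xi i j k (D.v l) = if l = i then (e ^ k) (D.v j) else 0 := by
  simpa using D.xi_apply_of_lt (i := i) (j := j) (k := k) (D.lam_pos l)

theorem xi_eq_zero {i j : Fin D.N} {k : ℕ} (h : D.lam j ≤ k) : D.xi i j k = 0 :=
  D.end_ext fun l a ha => by
    rw [D.xi_apply_of_lt ha, D.pow_apply_eq_zero (by omega), ite_self]; rfl

theorem commute_xi {i j : Fin D.N} {k : ℕ} (h : D.lam j ≤ D.lam i + k) :
    Commute e (D.xi i j k) :=
  D.end_ext fun l a _ => by
    rw [Module.End.mul_apply, Module.End.mul_apply, ← Module.End.mul_apply e (e ^ a), ← pow_succ',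
      D.xi_apply h, D.xi_apply h]
    split_ifs
    · rw [← Module.End.mul_apply, ← pow_succ']
      congr 2; ring
    · simp

theorem xi_mul_xi {l m : Fin D.N} {s : ℕ} (h : D.lam m ≤ D.lam l + s) (i j : Fin D.N) (r : ℕ) :
    D.xi l m s * D.xi i j r = if j = l then D.xi i m (r + s) else 0 :=
  D.end_ext fun n a ha => by
    rw [Module.End.mul_apply, D.xi_apply_of_lt ha]
    by_cases hn : n = i
    · rw [if_pos hn, D.xi_apply h]
      split_ifs with hj
      · rw [D.xi_apply_of_lt ha, if_pos hn, add_assoc]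
      · rfl
    · rw [if_neg hn, map_zero]
      split_ifs
      · rw [D.xi_apply_of_lt ha, if_neg hn]
      · rfl

theorem coord_xi (i j l m : Fin D.N) (r s : ℕ) :
    D.coord m s (D.xi i j r (D.v l)) = if l = i ∧ j = m ∧ r = s ∧ s < D.lam m then 1 else 0 := by
  rw [D.xi_apply_v]
  by_cases h : l = i
  · simp only [h, if_true, coord_pow, true_and]
  · simp [h]

/-- An endomorphism commuting with e is determined by its values on the generators. The sum also
runs over ξ's that do not commute with e; their coefficients vanish by `coord_eq_zero_of_commute`.
-/
theorem eq_sum_xi {x : End ℂ V} (hx : Commute e x) :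
    x = ∑ i, ∑ j, ∑ r ∈ Finset.range (D.lam j), D.coord j r (x (D.v i)) • D.xi i j r :=
  D.end_ext fun l a ha => by
    simp only [LinearMap.sum_apply, LinearMap.smul_apply, D.xi_apply_of_lt ha]
    rw [Finset.sum_eq_single l]
    · conv_lhs => rw [pow_apply_of_commute hx, ← D.sum_coord (x (D.v l))]
      simp only [map_sum, map_smul, if_true]
      refine Finset.sum_congr rfl fun j _ => Finset.sum_congr rfl fun r _ => ?_
      rw [pow_add, Module.End.mul_apply]
    · intro i _ hi
      simp [Ne.symm hi]
    · simp

/-- Applying e^(lam i) to x v_i gives 0, yet it carries this coefficient to e^(lam i + r) v_j, which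
is still a basis vector. -/
theorem coord_eq_zero_of_commute {x : End ℂ V} (hx : Commute e x) {i j : Fin D.N} {r : ℕ}
    (h : D.lam i + r < D.lam j) : D.coord j r (x (D.v i)) = 0 := by
  have h0 : D.coord j (D.lam i + r) ((e ^ D.lam i) (x (D.v i))) = 0 := by
    rw [← pow_apply_of_commute hx, D.pow_lam, map_zero, map_zero]
  rw [← D.sum_coord (x (D.v i))] at h0
  simp only [map_sum, map_smul, ← Module.End.mul_apply, ← pow_add, D.coord_pow] at h0
  rw [Finset.sum_eq_single j, Finset.sum_eq_single r] at h0
  · simpa [h] using h0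
  · intro b _ hb; simp [hb]
  · intro hr; exact absurd (Finset.mem_range.mpr (by omega)) hr
  · intro b _ hb; simp [hb]
  · simp

theorem eq_zero_of_coord {x : End ℂ V} (hx : Commute e x)
    (h : ∀ i j r, D.coord j r (x (D.v i)) = 0) : x = 0 := by
  rw [D.eq_sum_xi hx]
  simp [h]

theorem pow_v_mem (he : e ∈ glPart 𝒱 0) (i : Fin D.N) (a : ℕ) :
    (e ^ a) (D.v i) ∈ 𝒱 (D.par i) := by
  simpa using pow_mem_glPart he a _ _ (D.v_mem i)

theorem theta_mul_self (i : Fin D.N) : D.θ i * D.θ i = 1 := by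
  rcases D.θ_eq i with h | h <;> rw [h] <;> norm_num

theorem form_pow (i j : Fin D.N) (a b : ℕ) : β ((e ^ a) (D.v i)) ((e ^ b) (D.v j)) =
    if j = D.star i ∧ a + b + 1 = D.lam i then (-1) ^ a * D.θ i else 0 := by
  by_cases ha : a < D.lam i
  · by_cases hb : b < D.lam j
    · exact D.form_eq i j a ha b hb
    · rw [D.pow_apply_eq_zero (i := j) (by omega), map_zero, if_neg]
      rintro ⟨rfl, h⟩
      rw [D.lam_star] at hb
      omega
  · rw [D.pow_apply_eq_zero (i := i) (by omega), map_zero, LinearMap.zero_apply, if_neg]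
    rintro ⟨rfl, h⟩
    omega

theorem neg_one_pow_sq (n : ℕ) : ((-1 : ℂ) ^ n) * (-1) ^ n = 1 := by
  rw [← mul_pow]; simp

/-- Supersymmetry is applied to the pairing of e^(lam i - 1) v_i with v_{i*}. -/
theorem theta_star (hβ : IsSuperForm 𝒱 β) (he : e ∈ glPart 𝒱 0) (i : Fin D.N) :
    D.θ (D.star i) = (-1) ^ ((D.par i).val + D.lam i + 1) * D.θ i := by
  have hl := D.lam_pos i
  have h1 := hβ.supersymmetric _ _ _ (D.pow_v_mem he i (D.lam i - 1)) _
    (D.pow_v_mem he (D.star i) 0)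
  rw [D.form_pow, D.form_pow, if_pos ⟨rfl, by omega⟩,
    if_pos ⟨(D.star_star i).symm, by rw [D.lam_star]; omega⟩, D.par_star, sgn_self] at h1
  have h2 : (-1 : ℂ) ^ (D.lam i - 1) = (-1) ^ (D.lam i + 1) := by
    rw [show D.lam i + 1 = D.lam i - 1 + 2 by omega, pow_add]; simp
  rw [add_assoc, pow_add, ← h2, mul_assoc, h1, ← mul_assoc, neg_one_pow_sq]
  simp

theorem theta_star_mul (hβ : IsSuperForm 𝒱 β) (he : e ∈ glPart 𝒱 0) (i : Fin D.N) :
    D.θ (D.star i) * D.θ i = if D.star i = i then 1 else -1 := by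
  split_ifs with h
  · rw [h, D.theta_mul_self]
  · rw [D.theta_star hβ he, mul_assoc, D.theta_mul_self, mul_one]
    have h1 := (D.star_eq_iff i).not.mp h
    rcases zmod_two_cases (D.par i) with h2 | h2
    · have h3 : Even (D.lam i) := by
        rw [← Nat.not_odd_iff_even]; exact fun h4 => h1 (Or.inl ⟨h2, h4⟩)
      rw [h2]; simp [pow_add, h3.neg_one_pow]
    · have h3 : Odd (D.lam i) := by
        rw [← Nat.not_even_iff_odd]; exact fun h4 => h1 (Or.inr ⟨h2, h4⟩)
      rw [h2]; simp [pow_add, h3.neg_one_pow, ZMod.val_one]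

variable [DirectSum.Decomposition 𝒱]

theorem mem_glPart_of_basis (he : e ∈ glPart 𝒱 0) {p : ZMod 2} {x : End ℂ V}
    (h : ∀ i, ∀ a < D.lam i, x ((e ^ a) (D.v i)) ∈ 𝒱 (D.par i + p)) : x ∈ glPart 𝒱 p := by
  intro b u hu
  rw [← proj_of_mem hu, ← D.sum_coord u]
  simp only [map_sum, map_smul]
  refine Submodule.sum_mem _ fun i _ => Submodule.sum_mem _ fun a ha =>
    Submodule.smul_mem _ _ ?_
  rw [proj_of_mem_ite (D.pow_v_mem he i a)]
  split_ifs with hb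
  · rw [hb]; exact h i a (Finset.mem_range.mp ha)
  · rw [map_zero]; exact zero_mem _

theorem xi_mem_glPart (he : e ∈ glPart 𝒱 0) (i j : Fin D.N) (k : ℕ) :
    D.xi i j k ∈ glPart 𝒱 (D.par i + D.par j) := by
  refine D.mem_glPart_of_basis he fun l a ha => ?_
  rw [D.xi_apply_of_lt ha]
  split_ifs with h
  · subst h
    rw [← add_assoc, zmod_two_add_self, zero_add]
    exact D.pow_v_mem he j _
  · exact zero_mem _

theorem superBracket_xi (he : e ∈ glPart 𝒱 0) {i j l m : Fin D.N} {r s : ℕ}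
    (h : D.lam j ≤ D.lam i + r) (h' : D.lam m ≤ D.lam l + s) :
    superBracket 𝒱 (D.xi i j r) (D.xi l m s) = (if m = i then D.xi l j (s + r) else 0) -
      sgn (D.par i + D.par j) (D.par l + D.par m) • if j = l then D.xi i m (r + s) else 0 := by
  rw [superBracket_of_mem (D.xi_mem_glPart he _ _ _) (D.xi_mem_glPart he _ _ _), D.xi_mul_xi h,
    D.xi_mul_xi h']

variable [FiniteDimensional ℂ V] (hβ : IsSuperForm 𝒱 β)

theorem eq_sigma_of_basis (he : e ∈ glPart 𝒱 0) {p : ZMod 2} {x y : End ℂ V}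
    (hx : x ∈ glPart 𝒱 p) (h : ∀ i, ∀ a < D.lam i, ∀ j, ∀ b < D.lam j,
      β (y ((e ^ a) (D.v i))) ((e ^ b) (D.v j)) =
        -sgn p (D.par i) * β ((e ^ a) (D.v i)) (x ((e ^ b) (D.v j)))) : sigma hβ x = y := by
  refine D.end_ext fun i a ha => ?_
  have h2 : β (sigma hβ x ((e ^ a) (D.v i))) = β (y ((e ^ a) (D.v i))) := by
    refine D.basis.ext fun ⟨j, b⟩ => ?_
    rw [D.basis_apply, h i a ha j b b.2, sigma_spec hβ hx (D.pow_v_mem he i a)]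
  exact hβ.ext fun b w _ => by rw [h2]

/-- Both sides are tested against the form on basis vectors. They can be nonzero only on the chains
j* and i with a + b = k, where `eps` is the resulting sign. -/
theorem sigma_xi_sub (he : e ∈ glPart 𝒱 0) {i j : Fin D.N} {k : ℕ} (hi : k < D.lam i)
    (hj : k < D.lam j) : sigma hβ (D.xi i j (D.lam j - 1 - k)) =
      D.eps i j k • D.xi (D.star j) (D.star i) (D.lam i - 1 - k) := by
  refine D.eq_sigma_of_basis hβ he (D.xi_mem_glPart he i j _) fun l a ha n b hb => ?_
  rw [LinearMap.smul_apply, D.xi_apply_of_lt ha, D.xi_apply_of_lt hb, map_smul,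
    LinearMap.smul_apply, smul_eq_mul]
  by_cases hl : l = D.star j
  · subst hl
    by_cases hn : n = i
    · subst hn
      rw [if_pos rfl, if_pos rfl, D.form_pow, D.form_pow, D.star_star, D.star_star, D.lam_star,
        D.lam_star]
      by_cases hab : a + b = k
      · rw [if_pos ⟨rfl, by omega⟩, if_pos ⟨rfl, by omega⟩, D.theta_star hβ he,
          D.theta_star hβ he, eps, D.par_star]
        have e1 : (-1 : ℂ) ^ (a + (D.lam n - 1 - k)) = (-1) ^ (a + D.lam n + k + 1) := by
          rw [show a + D.lam n + k + 1 = a + (D.lam n - 1 - k) + 2 * (k + 1) by omega, pow_add _ _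
            (2 * (k + 1)), pow_mul]
          simp
        rw [e1]
        have h1 := neg_one_pow_sq k
        have h2 := neg_one_pow_sq (D.lam n)
        have h3 := D.theta_mul_self n
        -- In each parity case, what remains is an identity between signs that follows from their
        -- squares being 1.
        rcases zmod_two_cases (D.par n) with hp | hp <;>
        rcases zmod_two_cases (D.par j) with hq | hq <;>
        · simp only [hp, hq, pow_add, ZMod.val_zero, ZMod.val_one, zmod_two_add_self, sgn_zero_left,
            sgn_zero_right, sgn_one_one, add_zero, zero_add, pow_one, mul_zero, mul_one]
          generalize (-1 : ℂ) ^ k = K at *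
          generalize (-1 : ℂ) ^ (D.lam n) = L at *
          generalize (-1 : ℂ) ^ (D.lam j) = J at *
          generalize (-1 : ℂ) ^ a = A at *
          grind
      · rw [if_neg (by omega), if_neg (by omega)]; simp
    · rw [if_neg hn, if_pos rfl, D.form_pow, if_neg (by rw [D.star_star]; tauto)]; simp
  · rw [if_neg hl]
    by_cases hn : n = i
    · rw [if_pos hn, D.form_pow, if_neg]
      · simp
      · rintro ⟨h, _⟩
        exact hl (by rw [h, D.star_star])
    · rw [if_neg hn]; simp

theorem sigma_xi (he : e ∈ glPart 𝒱 0) {i j : Fin D.N} {r : ℕ} (h : D.lam j ≤ D.lam i + r) :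
    sigma hβ (D.xi i j r) =
      D.eps i j (D.lam j - 1 - r) • D.xi (D.star j) (D.star i) (r + D.lam i - D.lam j) := by
  by_cases hr : r < D.lam j
  · have := D.sigma_xi_sub hβ he (i := i) (j := j) (k := D.lam j - 1 - r) (by omega) (by omega)
    rw [show D.lam j - 1 - (D.lam j - 1 - r) = r by omega,
      show D.lam i - 1 - (D.lam j - 1 - r) = r + D.lam i - D.lam j by omega] at this
    exact this
  · rw [D.xi_eq_zero (by omega), D.xi_eq_zero (by rw [D.lam_star]; omega)]; simp

theorem sigma_xi_self (he : e ∈ glPart 𝒱 0) (i : Fin D.N) (r : ℕ) :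
    sigma hβ (D.xi i i r) = (-1 : ℂ) ^ (r + 1) • D.xi (D.star i) (D.star i) r := by
  by_cases hr : r < D.lam i
  · rw [D.sigma_xi hβ he (by omega), show r + D.lam i - D.lam i = r by omega, eps,
      zmod_two_add_self, ZMod.val_zero, mul_assoc, D.theta_mul_self]
    congr 1
    rw [zero_mul, add_zero, mul_one]
    exact neg_one_pow_congr (by rw [Nat.even_iff, Nat.even_iff]; omega)
  · rw [D.xi_eq_zero (by omega), D.xi_eq_zero (by rw [D.lam_star]; omega)]; simp

theorem sigma_xi_star (he : e ∈ glPart 𝒱 0) {i : Fin D.N} (hi : D.star i ≠ i) (r : ℕ) :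
    sigma hβ (D.xi i (D.star i) r) = (-1 : ℂ) ^ r • D.xi i (D.star i) r := by
  by_cases hr : r < D.lam i
  · rw [D.sigma_xi hβ he (by rw [D.lam_star]; omega), D.star_star, D.lam_star,
      show r + D.lam i - D.lam i = r by omega, eps, D.par_star,
      zmod_two_add_self, ZMod.val_zero, mul_assoc, D.theta_star_mul hβ he, if_neg hi, D.lam_star]
    congr 1
    rw [zero_mul, add_zero, ← pow_succ]
    exact neg_one_pow_congr (by rw [Nat.even_iff, Nat.even_iff]; omega)
  · rw [D.xi_eq_zero (by rw [D.lam_star]; omega)]; simp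

end AdaptedBasis

end Basics

/-! ### Symmetrized generators of the centralizer and two-sided bounds for the derived algebra. -/

section Derived

theorem bracketSpan_eq_map₂ {V : Type*} [AddCommGroup V] [Module ℂ V]
    {𝒱 : ZMod 2 → Submodule ℂ V} [DirectSum.Decomposition 𝒱] (A B : Submodule ℂ (End ℂ V)) :
    bracketSpan 𝒱 A B = Submodule.map₂ (superBracket 𝒱) A B := by
  refine le_antisymm (Submodule.span_le.mpr ?_) (Submodule.map₂_le.mpr ?_)
  · rintro _ ⟨x, hx, y, hy, rfl⟩
    exact Submodule.apply_mem_map₂ _ hx hy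
  · exact fun x hx y hy => Submodule.subset_span ⟨x, hx, y, hy, rfl⟩

theorem superBracket_mem_bracketSpan {V : Type*} [AddCommGroup V] [Module ℂ V]
    {𝒱 : ZMod 2 → Submodule ℂ V} [DirectSum.Decomposition 𝒱] {A B : Submodule ℂ (End ℂ V)}
    {x y : End ℂ V} (hx : x ∈ A) (hy : y ∈ B) : superBracket 𝒱 x y ∈ bracketSpan 𝒱 A B :=
  Submodule.subset_span ⟨x, hx, y, hy, rfl⟩

namespace AdaptedBasis

variable {V : Type*} [AddCommGroup V] [Module ℂ V] {𝒱 : ZMod 2 → Submodule ℂ V}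
variable {β : LinearMap.BilinForm ℂ V} {e : End ℂ V} (D : AdaptedBasis 𝒱 β e)

theorem star_injective : Function.Injective D.star := fun i j h => by
  rw [← D.star_star i, h, D.star_star]

theorem star_eq_comm {i j : Fin D.N} : D.star i = j ↔ D.star j = i :=
  ⟨fun h => by rw [← h, D.star_star], fun h => by rw [← h, D.star_star]⟩

/-- The involution moves an index by at most one, so it can reverse an order only by swapping two
neighbours. Thus i < j and j* > i* hold together, and σ turns pairs with i > j into pairs with i <
j. -/
theorem star_lt_star {i j : Fin D.N} (h : i < j) (hj : j ≠ D.star i) : D.star i < D.star j := by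
  have h1 := D.star_near i
  have h2 := D.star_near j
  have h3 : (D.star i : ℕ) ≠ D.star j := fun h3 => h.ne (D.star_injective (Fin.ext h3))
  have h4 : (j : ℕ) ≠ D.star i := fun h4 => hj (Fin.ext h4)
  have h5 : (i : ℕ) < j := h
  show (D.star i : ℕ) < D.star j
  omega

variable [DirectSum.Decomposition 𝒱]

theorem commute_of_mem_centralizer (he : e ∈ glPart 𝒱 0) {x : End ℂ V}
    (hx : x ∈ centralizer 𝒱 β e) : Commute e x := by
  have := LinearMap.mem_ker.mp hx.2
  rw [superBracket_even he] at this
  exact sub_eq_zero.mp this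

variable [FiniteDimensional ℂ V] (hβ : IsSuperForm 𝒱 β)

/-- The symmetrization of `ξ_i^{j,r}`. -/
def sxi (i j : Fin D.N) (r : ℕ) : End ℂ V := symm hβ (D.xi i j r)

theorem sxi_eq (he : e ∈ glPart 𝒱 0) {i j : Fin D.N} {r : ℕ} (h : D.lam j ≤ D.lam i + r) :
    D.sxi hβ i j r = D.xi i j r +
      D.eps i j (D.lam j - 1 - r) • D.xi (D.star j) (D.star i) (r + D.lam i - D.lam j) := by
  rw [sxi, symm_apply, D.sigma_xi hβ he h]

theorem sxi_eq_zero {i j : Fin D.N} {r : ℕ} (h : D.lam j ≤ r) : D.sxi hβ i j r = 0 := by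
  rw [sxi, D.xi_eq_zero h, map_zero]

theorem sxi_eq_smul (he : e ∈ glPart 𝒱 0) {i j : Fin D.N} {r : ℕ} (h : D.lam j ≤ D.lam i + r) :
    D.sxi hβ i j r =
      D.eps i j (D.lam j - 1 - r) •
        D.sxi hβ (D.star j) (D.star i) (r + D.lam i - D.lam j) := by
  rw [sxi, ← symm_sigma, D.sigma_xi hβ he h, map_smul, sxi]

theorem sxi_self (he : e ∈ glPart 𝒱 0) (i : Fin D.N) (r : ℕ) :
    D.sxi hβ i i r = D.xi i i r + (-1 : ℂ) ^ (r + 1) • D.xi (D.star i) (D.star i) r := by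
  rw [sxi, symm_apply, D.sigma_xi_self hβ he]

theorem sxi_star_star (he : e ∈ glPart 𝒱 0) (i : Fin D.N) (r : ℕ) :
    D.sxi hβ (D.star i) (D.star i) r = (-1 : ℂ) ^ (r + 1) • D.sxi hβ i i r := by
  rw [sxi, ← symm_sigma, D.sigma_xi_self hβ he, D.star_star, map_smul, sxi]

theorem sxi_star (he : e ∈ glPart 𝒱 0) {i : Fin D.N} (hi : D.star i ≠ i) (r : ℕ) :
    D.sxi hβ i (D.star i) r = (1 + (-1 : ℂ) ^ r) • D.xi i (D.star i) r := by
  rw [sxi, symm_apply, D.sigma_xi_star hβ he hi, add_smul, one_smul]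

theorem zeta_eq (he : e ∈ glPart 𝒱 0) {i j : Fin D.N} {k : ℕ} (hi : k < D.lam i)
    (hj : k < D.lam j) : D.zeta i j k = D.sxi hβ i j (D.lam j - 1 - k) := by
  rw [zeta, sxi, symm_apply, D.sigma_xi_sub hβ he hi hj]

theorem commute_sxi (he : e ∈ glPart 𝒱 0) {i j : Fin D.N} {r : ℕ} (h : D.lam j ≤ D.lam i + r) :
    Commute e (D.sxi hβ i j r) := by
  rw [D.sxi_eq hβ he h]
  refine (D.commute_xi h).add_right ((D.commute_xi ?_).smul_right _)
  rw [D.lam_star, D.lam_star]; omega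

theorem sxi_mem_glPart (he : e ∈ glPart 𝒱 0) (i j : Fin D.N) (r : ℕ) :
    D.sxi hβ i j r ∈ glPart 𝒱 (D.par i + D.par j) :=
  add_mem (D.xi_mem_glPart he i j r) (sigma_mem hβ (D.xi_mem_glPart he i j r))

theorem sxi_mem_centralizer (he : e ∈ glPart 𝒱 0) {i j : Fin D.N} {r : ℕ}
    (h : D.lam j ≤ D.lam i + r) : D.sxi hβ i j r ∈ centralizer 𝒱 β e := by
  refine ⟨symm_mem_osp hβ (D.xi_mem_glPart he i j r), ?_⟩
  rw [SetLike.mem_coe, LinearMap.mem_ker, superBracket_even he, (D.commute_sxi hβ he h).eq, sub_self]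

/-- An element of osp(V) is half its own symmetrization, so the expansion in ξ's can be symmetrized
term by term. -/
theorem centralizer_eq_span (he : e ∈ glPart 𝒱 0) : centralizer 𝒱 β e =
    Submodule.span ℂ {x | ∃ i j r, D.lam j ≤ D.lam i + r ∧ x = D.sxi hβ i j r} := by
  refine le_antisymm (fun x hx => ?_) (Submodule.span_le.mpr ?_)
  · have h1 := commute_of_mem_centralizer he hx
    have h2 : x = (2⁻¹ : ℂ) • symm hβ x := by
      rw [symm_apply, sigma_of_mem_osp hβ hx.1, ← two_smul ℂ x, smul_smul]; simp
    rw [h2, D.eq_sum_xi h1]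
    simp only [map_sum, map_smul]
    refine Submodule.smul_mem _ _ (Submodule.sum_mem _ fun i _ => Submodule.sum_mem _ fun j _ =>
      Submodule.sum_mem _ fun r _ => ?_)
    by_cases h : D.lam j ≤ D.lam i + r
    · exact Submodule.smul_mem _ _ (Submodule.subset_span ⟨i, j, r, h, rfl⟩)
    · rw [D.coord_eq_zero_of_commute h1 (by omega), zero_smul]; exact zero_mem _
  · rintro _ ⟨i, j, r, h, rfl⟩
    exact D.sxi_mem_centralizer hβ he h

theorem superBracket_sxi' (he : e ∈ glPart 𝒱 0) (i j l m : Fin D.N) (r s : ℕ) :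
    superBracket 𝒱 (D.sxi hβ i j r) (D.sxi hβ l m s) =
      symm hβ (superBracket 𝒱 (D.xi i j r) (D.xi l m s)) +
      symm hβ (superBracket 𝒱 (D.xi i j r) (sigma hβ (D.xi l m s))) :=
  superBracket_symm hβ (D.xi_mem_glPart he i j r) (D.xi_mem_glPart he l m s)

theorem superBracket_sxi (he : e ∈ glPart 𝒱 0) {i j l m : Fin D.N} {r s : ℕ}
    (h : D.lam j ≤ D.lam i + r) (h' : D.lam m ≤ D.lam l + s) :
    superBracket 𝒱 (D.sxi hβ i j r) (D.sxi hβ l m s) =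
      ((if m = i then D.sxi hβ l j (s + r) else 0) - sgn (D.par i + D.par j) (D.par l + D.par m) •
        if j = l then D.sxi hβ i m (r + s) else 0) +
      D.eps l m (D.lam m - 1 - s) •
        ((if D.star l = i then D.sxi hβ (D.star m) j (s + D.lam l - D.lam m + r) else 0) -
        sgn (D.par i + D.par j) (D.par l + D.par m) •
          if j = D.star m then D.sxi hβ i (D.star l) (r + (s + D.lam l - D.lam m)) else 0) := by
  have h'' : D.lam (D.star l) ≤ D.lam (D.star m) + (s + D.lam l - D.lam m) := by
    rw [D.lam_star, D.lam_star]; omega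
  rw [D.superBracket_sxi' hβ he, D.sigma_xi hβ he h', map_smul, D.superBracket_xi he h h',
    D.superBracket_xi he h h'', D.par_star, D.par_star, add_comm (D.par m)]
  simp only [map_sub, map_smul, sxi, apply_ite (symm hβ), map_zero]

theorem sxi_mem_N₂ (he : e ∈ glPart 𝒱 0) {i j : Fin D.N} {r : ℕ} (h : D.lam j ≤ D.lam i + r)
    (hj : j ≠ i) (hj' : j ≠ D.star i) : D.sxi hβ i j r ∈ D.N₂ := by
  have key : ∀ {i j : Fin D.N} {r : ℕ}, D.lam j ≤ D.lam i + r → i < j → j ≠ D.star i →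
      D.sxi hβ i j r ∈ D.N₂ := by
    intro i j r h hij hj'
    by_cases hr : r < D.lam j
    · refine Submodule.subset_span ⟨i, j, D.lam j - 1 - r, ?_, hij, hj', ?_⟩
      · rw [lt_min_iff]; omega
      · rw [D.zeta_eq hβ he (by omega) (by omega), show D.lam j - 1 - (D.lam j - 1 - r) = r by omega]
    · rw [D.sxi_eq_zero hβ (by omega)]; exact zero_mem _
  rcases lt_or_gt_of_ne hj with hlt | hlt
  · rw [D.sxi_eq_smul hβ he h]
    refine Submodule.smul_mem _ _ (key ?_ (D.star_lt_star hlt ?_) ?_)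
    · rw [D.lam_star, D.lam_star]; omega
    · intro h3; exact hj' (by rw [h3, D.star_star])
    · rw [D.star_star]; intro h3; exact hj' h3.symm
  · exact key h hlt hj'

/-- σ acts on ξ_i^{i*,r} by (-1)^r, so only even exponents survive symmetrization. -/
theorem sxi_mem_N₁ (he : e ∈ glPart 𝒱 0) {i : Fin D.N} (hi : D.star i ≠ i) (r : ℕ) :
    D.sxi hβ i (D.star i) r ∈ D.N₁ := by
  rw [D.sxi_star hβ he hi]
  rcases Nat.even_or_odd r with h | h
  · refine Submodule.smul_mem _ _ ?_
    by_cases hr : r < D.lam i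
    · refine Submodule.subset_span ⟨i, D.lam i - 1 - r, by omega, hi.symm, ?_, ?_⟩
      · rw [show D.lam i - (D.lam i - 1 - r) = r + 1 by omega]
        exact h.add_one
      · rw [show D.lam i - 1 - (D.lam i - 1 - r) = r by omega]
    · rw [D.xi_eq_zero (by rw [D.lam_star]; omega)]; exact zero_mem _
  · rw [h.neg_one_pow, add_neg_cancel, zero_smul]; exact zero_mem _

theorem sxi_self_mem_𝔑₁ (he : e ∈ glPart 𝒱 0) (i : Fin D.N) {r : ℕ} (h : Even r) :
    D.sxi hβ i i r ∈ D.𝔑₁ := by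
  rw [D.sxi_self hβ he, h.add_one.neg_one_pow, neg_smul, one_smul, ← sub_eq_add_neg]
  by_cases hi : D.star i = i
  · rw [hi, sub_self]; exact zero_mem _
  by_cases hr : r < D.lam i
  · refine Submodule.subset_span ⟨i, D.lam i - 1 - r, by omega, Ne.symm hi, ?_, ?_⟩
    · rw [show D.lam i - (D.lam i - 1 - r) = r + 1 by omega]
      exact h.add_one
    · rw [show D.lam i - 1 - (D.lam i - 1 - r) = r by omega]
  · rw [D.xi_eq_zero (by omega), D.xi_eq_zero (by rw [D.lam_star]; omega), sub_zero]
    exact zero_mem _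

theorem sxi_self_mem_𝔑₀ (he : e ∈ glPart 𝒱 0) (i : Fin D.N) {r : ℕ} (h : Odd r) :
    D.sxi hβ i i r ∈ D.𝔑₀ := by
  rw [D.sxi_self hβ he, h.add_one.neg_one_pow, one_smul]
  by_cases hr : r < D.lam i
  · have h1 : Even (D.lam i - (D.lam i - 1 - r)) := by
      rw [show D.lam i - (D.lam i - 1 - r) = r + 1 by omega]
      exact h.add_one
    have h2 : r = D.lam i - 1 - (D.lam i - 1 - r) := by omega
    by_cases hi : D.star i = i
    · rw [hi]
      have : D.xi i i r ∈ D.𝔑₀ := Submodule.subset_span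
        (Or.inl ⟨i, D.lam i - 1 - r, by omega, hi.symm, h1, by rw [← h2]⟩)
      exact add_mem this this
    · exact Submodule.subset_span
        (Or.inr ⟨i, D.lam i - 1 - r, by omega, Ne.symm hi, h1, by rw [← h2]⟩)
  · rw [D.xi_eq_zero (by omega), D.xi_eq_zero (by rw [D.lam_star]; omega), add_zero]
    exact zero_mem _

theorem sxi_mem_sup_of_ne (he : e ∈ glPart 𝒱 0) {i j : Fin D.N} {r : ℕ}
    (h : D.lam j ≤ D.lam i + r) (hj : j ≠ i) : D.sxi hβ i j r ∈ D.N₁ ⊔ D.N₂ := by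
  by_cases hj' : j = D.star i
  · subst hj'
    exact Submodule.mem_sup_left (D.sxi_mem_N₁ hβ he hj r)
  · exact Submodule.mem_sup_right (D.sxi_mem_N₂ hβ he h hj hj')

/-! ### Upper bound for the derived algebra -/

theorem superBracket_sxi_self (he : e ∈ glPart 𝒱 0) (i l : Fin D.N) (r s : ℕ) :
    superBracket 𝒱 (D.sxi hβ i i r) (D.sxi hβ l l s) = 0 := by
  have key : ∀ m, superBracket 𝒱 (D.xi i i r) (D.xi m m s) = 0 := by
    intro m
    rw [D.superBracket_xi he (by omega) (by omega), zmod_two_add_self, sgn_zero_left, one_smul]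
    by_cases hm : m = i
    · subst hm; rw [if_pos rfl, if_pos rfl, add_comm, sub_self]
    · rw [if_neg hm, if_neg (Ne.symm hm), sub_zero]
  rw [D.superBracket_sxi' hβ he, D.sigma_xi_self hβ he, map_smul, key, key]
  simp

theorem superBracket_sxi_star (he : e ∈ glPart 𝒱 0) {i : Fin D.N} (hi : D.star i ≠ i) (r s : ℕ) :
    superBracket 𝒱 (D.sxi hβ i (D.star i) r) (D.sxi hβ (D.star i) i s) =
      (1 + (-1 : ℂ) ^ s) • (D.sxi hβ (D.star i) (D.star i) (s + r) - D.sxi hβ i i (r + s)) := by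
  have h2 : sigma hβ (D.xi (D.star i) i s) = (-1 : ℂ) ^ s • D.xi (D.star i) i s := by
    have := D.sigma_xi_star hβ he (i := D.star i) (by rw [D.star_star]; exact hi.symm) s
    rwa [D.star_star] at this
  rw [D.superBracket_sxi' hβ he, h2, map_smul, map_smul, D.superBracket_xi he
    (by rw [D.lam_star]; omega) (by rw [D.lam_star]; omega), D.par_star, zmod_two_add_self,
    sgn_zero_left, one_smul, if_pos rfl, if_pos rfl, map_sub, add_smul, one_smul]
  rfl

theorem superBracket_sxi_mem (he : e ∈ glPart 𝒱 0) {i j l m : Fin D.N} {r s : ℕ}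
    (h : D.lam j ≤ D.lam i + r) (h' : D.lam m ≤ D.lam l + s) :
    superBracket 𝒱 (D.sxi hβ i j r) (D.sxi hβ l m s) ∈
      D.N₁ ⊔ D.N₂ ⊔ D.𝔑₁ ⊔ (D.𝔑₀ ⊓ bracketSpan 𝒱 D.N₂ D.N₂) := by
  set T := D.N₁ ⊔ D.N₂ ⊔ D.𝔑₁ ⊔ (D.𝔑₀ ⊓ bracketSpan 𝒱 D.N₂ D.N₂) with hT
  have hN : D.N₁ ⊔ D.N₂ ≤ T := le_sup_left.trans le_sup_left
  have h𝔑 : D.𝔑₁ ≤ T := le_sup_right.trans le_sup_left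
  have h0 : D.𝔑₀ ⊓ bracketSpan 𝒱 D.N₂ D.N₂ ≤ T := le_sup_right
  -- For j ≠ i, these are the only configurations in which diagonal terms occur, either from the
  -- bracket of the ξ's or from the bracket with the σ-image.
  by_cases hA : (m = i ∧ l = j) ∨ (D.star l = i ∧ D.star m = j)
  · by_cases hji : j = i
    · subst hji
      have hml : m = l := by
        rcases hA with ⟨rfl, rfl⟩ | ⟨h1, h2⟩
        · rfl
        · exact D.star_injective (by rw [h1, h2])
      subst hml
      rw [D.superBracket_sxi_self hβ he]; exact zero_mem _
    by_cases hjs : j = D.star i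
    · subst hjs
      have hml : m = i ∧ l = D.star i := by
        rcases hA with h1 | ⟨h1, h2⟩
        · exact h1
        · exact ⟨D.star_injective h2, (D.star_eq_comm.mp h1).symm⟩
      obtain ⟨rfl, rfl⟩ := hml
      rcases Nat.even_or_odd r with hr | hr
      · rw [D.superBracket_sxi_star hβ he hji]
        rcases Nat.even_or_odd s with hs | hs
        · exact h𝔑 (Submodule.smul_mem _ _ (sub_mem (D.sxi_self_mem_𝔑₁ hβ he _ (hs.add hr))
            (D.sxi_self_mem_𝔑₁ hβ he _ (hr.add hs))))
        · rw [hs.neg_one_pow, add_neg_cancel, zero_smul]; exact zero_mem _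
      · rw [D.sxi_star hβ he hji, hr.neg_one_pow, add_neg_cancel, zero_smul, map_zero,
          LinearMap.zero_apply]
        exact zero_mem _
    · have h3 : m ≠ l ∧ m ≠ D.star l := by
        rcases hA with ⟨rfl, rfl⟩ | ⟨rfl, rfl⟩
        · exact ⟨Ne.symm hji, fun h3 => hjs (by rw [h3, D.star_star])⟩
        · exact ⟨fun h3 => hji (by rw [h3]), fun h3 => hjs (by rw [h3])⟩
      have hb : superBracket 𝒱 (D.sxi hβ i j r) (D.sxi hβ l m s) ∈ bracketSpan 𝒱 D.N₂ D.N₂ :=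
        superBracket_mem_bracketSpan (D.sxi_mem_N₂ hβ he h hji hjs)
          (D.sxi_mem_N₂ hβ he h' h3.1 h3.2)
      -- Both diagonal terms have the same exponent t. For odd t the whole bracket therefore lies in
      -- 𝔑_0, as the intersection with [N_2, N_2] requires.
      have hform : ∃ t, ∃ c d : ℂ, superBracket 𝒱 (D.sxi hβ i j r) (D.sxi hβ l m s) =
          c • D.sxi hβ j j t + d • D.sxi hβ i i t := by
        rw [D.superBracket_sxi hβ he h h']
        rcases hA with ⟨rfl, rfl⟩ | ⟨rfl, rfl⟩
        · rw [if_pos rfl, if_pos rfl, if_neg (fun h4 => hjs (D.star_eq_comm.mp h4).symm), if_neg hjs]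
          refine ⟨s + r, 1, -sgn (D.par m + D.par l) (D.par l + D.par m), ?_⟩
          rw [add_comm r s]; module
        · rw [if_pos rfl, if_pos rfl, if_neg h3.2, if_neg (fun h4 => h3.2 (by rw [← h4, D.star_star]))]
          refine ⟨s + D.lam l - D.lam m + r, D.eps l m (D.lam m - 1 - s), -(D.eps l m (D.lam m - 1 - s) *
            sgn (D.par (D.star l) + D.par (D.star m)) (D.par l + D.par m)), ?_⟩
          rw [add_comm r]; module
      obtain ⟨t, c, d, hform⟩ := hform
      rcases Nat.even_or_odd t with ht | ht
      · rw [hform]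
        exact h𝔑 (add_mem (Submodule.smul_mem _ _ (D.sxi_self_mem_𝔑₁ hβ he _ ht))
          (Submodule.smul_mem _ _ (D.sxi_self_mem_𝔑₁ hβ he _ ht)))
      · refine h0 ⟨?_, hb⟩
        rw [hform]
        exact add_mem (Submodule.smul_mem _ _ (D.sxi_self_mem_𝔑₀ hβ he _ ht))
          (Submodule.smul_mem _ _ (D.sxi_self_mem_𝔑₀ hβ he _ ht))
  · push Not at hA
    have hite : ∀ {p : Prop} [Decidable p] {x : End ℂ V}, (p → x ∈ D.N₁ ⊔ D.N₂) →
        (if p then x else 0) ∈ D.N₁ ⊔ D.N₂ := by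
      intro p _ x hx
      split_ifs with hp
      · exact hx hp
      · exact zero_mem _
    refine hN ?_
    rw [D.superBracket_sxi hβ he h h']
    refine add_mem (sub_mem (hite fun h1 => ?_) (Submodule.smul_mem _ _ (hite fun h1 => ?_)))
      (Submodule.smul_mem _ _ (sub_mem (hite fun h1 => ?_)
        (Submodule.smul_mem _ _ (hite fun h1 => ?_))))
    · subst h1
      exact D.sxi_mem_sup_of_ne hβ he (by omega) fun h2 => hA.1 rfl h2.symm
    · subst h1
      exact D.sxi_mem_sup_of_ne hβ he (by omega) fun h2 => hA.1 h2 rfl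
    · subst h1
      refine D.sxi_mem_sup_of_ne hβ he ?_ fun h2 => hA.2 rfl h2.symm
      rw [D.lam_star] at h ⊢; omega
    · subst h1
      refine D.sxi_mem_sup_of_ne hβ he ?_ fun h2 => hA.2 h2 rfl
      rw [D.lam_star] at h ⊢; omega

theorem derived_eq_span (he : e ∈ glPart 𝒱 0) :
    bracketSpan 𝒱 (centralizer 𝒱 β e) (centralizer 𝒱 β e) =
      Submodule.span ℂ {x | ∃ i j r, D.lam j ≤ D.lam i + r ∧ ∃ l m s, D.lam m ≤ D.lam l + s ∧
        x = superBracket 𝒱 (D.sxi hβ i j r) (D.sxi hβ l m s)} := by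
  rw [bracketSpan_eq_map₂, D.centralizer_eq_span hβ he, Submodule.map₂_span_span]
  congr 1
  ext x
  constructor
  · rintro ⟨_, ⟨i, j, r, h, rfl⟩, _, ⟨l, m, s, h', rfl⟩, rfl⟩
    exact ⟨i, j, r, h, l, m, s, h', rfl⟩
  · rintro ⟨i, j, r, h, l, m, s, h', rfl⟩
    exact ⟨_, ⟨i, j, r, h, rfl⟩, _, ⟨l, m, s, h', rfl⟩, rfl⟩

include hβ in
theorem derived_le (he : e ∈ glPart 𝒱 0) :
    bracketSpan 𝒱 (centralizer 𝒱 β e) (centralizer 𝒱 β e) ≤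
      D.N₁ ⊔ D.N₂ ⊔ D.𝔑₁ ⊔ (D.𝔑₀ ⊓ bracketSpan 𝒱 D.N₂ D.N₂) := by
  rw [D.derived_eq_span hβ he, Submodule.span_le]
  rintro _ ⟨i, j, r, h, l, m, s, h', rfl⟩
  exact D.superBracket_sxi_mem hβ he h h'

/-! ### Lower bound for the derived algebra -/

theorem superBracket_sxi_mem_derived (he : e ∈ glPart 𝒱 0) {i j l m : Fin D.N} {r s : ℕ}
    (h : D.lam j ≤ D.lam i + r) (h' : D.lam m ≤ D.lam l + s) :
    superBracket 𝒱 (D.sxi hβ i j r) (D.sxi hβ l m s) ∈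
      bracketSpan 𝒱 (centralizer 𝒱 β e) (centralizer 𝒱 β e) :=
  superBracket_mem_bracketSpan (D.sxi_mem_centralizer hβ he h) (D.sxi_mem_centralizer hβ he h')

include hβ in
theorem N₁_le_derived (he : e ∈ glPart 𝒱 0) :
    D.N₁ ≤ bracketSpan 𝒱 (centralizer 𝒱 β e) (centralizer 𝒱 β e) := by
  refine Submodule.span_le.mpr ?_
  rintro _ ⟨i, k, hk, hi, hodd, rfl⟩
  have hs : Even (D.lam i - 1 - k) := by
    rw [Nat.odd_iff] at hodd; rw [Nat.even_iff]; omega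
  generalize D.lam i - 1 - k = s at hs
  -- `sxi i i 0` is +1 on the chain of i and -1 on that of i*, and both halves of the symmetrized
  -- bracket agree. The bracket is -4 times the wanted element.
  have h1 := D.superBracket_sxi_mem_derived hβ he (i := i) (j := i) (l := i) (m := D.star i)
    (r := 0) (s := s) (by omega) (by rw [D.lam_star]; omega)
  rw [D.superBracket_sxi' hβ he, D.sigma_xi_star hβ he hi.symm, hs.neg_one_pow, one_smul,
    D.superBracket_xi he (by omega) (by rw [D.lam_star]; omega), if_neg hi.symm, if_pos rfl,
    zmod_two_add_self, sgn_zero_left, one_smul, zero_sub, map_neg, zero_add, ← sxi,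
    D.sxi_star hβ he hi.symm, hs.neg_one_pow] at h1
  have := Submodule.smul_mem _ (-4⁻¹ : ℂ) h1
  rw [SetLike.mem_coe]
  convert this using 1
  module

include hβ in
theorem 𝔑₁_le_derived (he : e ∈ glPart 𝒱 0) :
    D.𝔑₁ ≤ bracketSpan 𝒱 (centralizer 𝒱 β e) (centralizer 𝒱 β e) := by
  refine Submodule.span_le.mpr ?_
  rintro _ ⟨i, k, hk, hi, hodd, rfl⟩
  have hs : Even (D.lam i - 1 - k) := by
    rw [Nat.odd_iff] at hodd; rw [Nat.even_iff]; omega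
  generalize D.lam i - 1 - k = s at hs
  -- For even s this bracket is again -4 times the wanted element: a factor 2 comes from σ, and the
  -- two diagonal terms are negatives of each other.
  have h1 := D.superBracket_sxi_mem_derived hβ he (i := i) (j := D.star i) (l := D.star i) (m := i)
    (r := s) (s := 0) (by rw [D.lam_star]; omega) (by rw [D.lam_star]; omega)
  rw [D.superBracket_sxi_star hβ he hi.symm, zero_add, add_zero, D.sxi_star_star hβ he,
    D.sxi_self hβ he, hs.add_one.neg_one_pow] at h1
  have := Submodule.smul_mem _ (-4⁻¹ : ℂ) h1
  rw [SetLike.mem_coe]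
  convert this using 1
  module

include hβ in
-- If i or j is moved by the involution, bracketing with `sxi i i 0` or `sxi j j 0` reproduces ζ up
-- to sign. If both are fixed these elements vanish, and `sxi i i 1` raises the exponent from s - 1
-- to s. For s = 0 a third chain has to serve as intermediary.
theorem zeta_mem_derived (he : e ∈ glPart 𝒱 0) {i j : Fin D.N} {k : ℕ} (hi : k < D.lam i)
    (hj : k < D.lam j) (hij : i < j) (hj' : j ≠ D.star i) (hm : D.zeta i j k ∉ D.N₂MinusSet) :
    D.zeta i j k ∈ bracketSpan 𝒱 (centralizer 𝒱 β e) (centralizer 𝒱 β e) := by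
  have hlam := D.lam_antitone hij.le
  have hs : ∃ s, s = D.lam j - 1 - k := ⟨_, rfl⟩
  obtain ⟨s, hs⟩ := hs
  have hz := D.zeta_eq hβ he hi hj
  rw [← hs] at hz
  have hs' : D.lam (D.star i) ≤ D.lam (D.star j) + (s + D.lam i - D.lam j) := by
    rw [D.lam_star, D.lam_star]; omega
  by_cases h1 : D.star i = i
  · by_cases h2 : D.star j = j
    · rcases Nat.eq_zero_or_pos s with h0 | h0
      -- Without such an l, the indices i and j are adjacent and the chains next to them are
      -- strictly longer and strictly shorter, so ζ would belong to `N₂MinusSet`.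
      · have hl : ∃ l, l ≠ i ∧ l ≠ j ∧ D.lam l ≤ D.lam i ∧ D.lam j ≤ D.lam l := by
          by_contra hl
          push Not at hl
          have h3 : (j : ℕ) = i + 1 := by
            by_contra h3
            have h4 : (i : ℕ) < j := hij
            have h5 : (i : ℕ) + 1 < D.N := by omega
            have h6 := hl ⟨i + 1, h5⟩ (fun h => by simp [Fin.ext_iff] at h)
              (fun h => h3 (by simp [Fin.ext_iff] at h; omega))
              (D.lam_antitone (by rw [Fin.le_def]; simp))
            have h7 : D.lam j ≤ D.lam ⟨i + 1, h5⟩ :=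
              D.lam_antitone (by rw [Fin.le_def]; show (i : ℕ) + 1 ≤ j; omega)
            omega
          refine hm ⟨i, j, h3, h1.symm, h2.symm, fun l h4 => ?_, fun l h4 => ?_, ?_⟩
          · by_contra h5
            have h6 := hl l (fun h => by rw [h] at h4; omega) (fun h => by rw [h] at h4; omega)
              (by omega)
            have h7 : D.lam i ≤ D.lam l := D.lam_antitone (by rw [Fin.le_def]; omega)
            omega
          · have h7 : D.lam l ≤ D.lam j := D.lam_antitone (by rw [Fin.le_def]; omega)
            exact hl l (fun h => by rw [h] at h4; omega) (fun h => by rw [h] at h4; omega)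
              (by omega)
          · rw [show k = D.lam j - 1 by omega]
        obtain ⟨l, hli, hlj, h3, h4⟩ := hl
        have h5 := D.superBracket_sxi_mem_derived hβ he (i := l) (j := j) (l := i) (m := l)
          (r := 0) (s := 0) (by omega) (by omega)
        rw [D.superBracket_sxi hβ he (by omega) (by omega), if_pos rfl, if_neg hij.ne',
          if_neg (by rw [h1]; exact hli.symm),
          if_neg (fun h => hlj (by rw [← h2, h, D.star_star]))] at h5
        rw [hz, h0]
        simpa using h5
      · have h3 := D.superBracket_sxi_mem_derived hβ he (i := i) (j := j) (l := i) (m := i)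
          (r := s - 1) (s := 1) (by omega) (by omega)
        rw [D.superBracket_sxi' hβ he, D.sigma_xi_self hβ he, h1,
          D.superBracket_xi he (by omega) (by omega), if_pos rfl, if_neg hij.ne',
          show 1 + (s - 1) = s by omega, smul_zero, sub_zero, show (-1 : ℂ) ^ (1 + 1) = 1 by norm_num,
          one_smul, D.superBracket_xi he (by omega) (by omega), if_pos rfl, if_neg hij.ne',
          show 1 + (s - 1) = s by omega, smul_zero, sub_zero, ← sxi] at h3
        rw [hz]
        have := Submodule.smul_mem _ (2⁻¹ : ℂ) h3
        convert this using 1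
        module
    · have h3 := D.superBracket_sxi_mem_derived hβ he (i := j) (j := j) (l := i) (m := j)
        (r := 0) (s := s) (by omega) (by omega)
      rw [D.superBracket_sxi hβ he (by omega) (by omega), if_pos rfl, if_neg hij.ne',
        if_neg (Ne.symm hj'), if_neg (Ne.symm h2)] at h3
      rw [hz]
      simpa using h3
  · have h3 := D.superBracket_sxi_mem_derived hβ he (i := i) (j := i) (l := i) (m := j)
      (r := 0) (s := s) (by omega) (by omega)
    rw [D.superBracket_sxi hβ he (by omega) (by omega), if_neg hij.ne', if_pos rfl, if_neg h1,
      if_neg (fun h => hj' (by rw [h, D.star_star])), zmod_two_add_self, sgn_zero_left] at h3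
    rw [hz]
    simpa using h3

include hβ in
theorem N₂Plus_le_derived (he : e ∈ glPart 𝒱 0) :
    D.N₂Plus ≤ bracketSpan 𝒱 (centralizer 𝒱 β e) (centralizer 𝒱 β e) := by
  refine Submodule.span_le.mpr ?_
  rintro _ ⟨⟨i, j, k, hk, hij, hj, rfl⟩, hm⟩
  rw [lt_min_iff] at hk
  exact D.zeta_mem_derived hβ he hk.1 hk.2 hij hj hm

include hβ in
theorem N₂_le_centralizer (he : e ∈ glPart 𝒱 0) : D.N₂ ≤ centralizer 𝒱 β e := by
  refine Submodule.span_le.mpr ?_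
  rintro _ ⟨i, j, k, hk, hij, hj, rfl⟩
  rw [lt_min_iff] at hk
  rw [D.zeta_eq hβ he hk.1 hk.2]
  exact D.sxi_mem_centralizer hβ he (by omega)

end AdaptedBasis

end Derived

/-! ### Directness of the sum, and the functionals that detect N_2^-. -/

section Coefficients

namespace AdaptedBasis

variable {V : Type*} [AddCommGroup V] [Module ℂ V] {𝒱 : ZMod 2 → Submodule ℂ V}
variable {β : LinearMap.BilinForm ℂ V} {e : End ℂ V} (D : AdaptedBasis 𝒱 β e)

/-- The endomorphisms commuting with `e` whose coefficients at `ξ_i^{j,r}` vanish unless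
`P i j r`. -/
def supported (P : Fin D.N → Fin D.N → ℕ → Prop) : Submodule ℂ (End ℂ V) where
  carrier := {x | Commute e x ∧ ∀ i j r, ¬ P i j r → D.coord j r (x (D.v i)) = 0}
  add_mem' hx hy := ⟨hx.1.add_right hy.1, fun i j r h => by
    rw [LinearMap.add_apply, map_add, hx.2 i j r h, hy.2 i j r h, add_zero]⟩
  zero_mem' := ⟨Commute.zero_right _, fun i j r _ => by simp⟩
  smul_mem' c x hx := ⟨hx.1.smul_right c, fun i j r h => by
    rw [LinearMap.smul_apply, map_smul, hx.2 i j r h, smul_zero]⟩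

theorem supported_mono {P Q : Fin D.N → Fin D.N → ℕ → Prop} (h : ∀ i j r, P i j r → Q i j r) :
    D.supported P ≤ D.supported Q :=
  fun _ hx => ⟨hx.1, fun i j r hQ => hx.2 i j r fun hP => hQ (h i j r hP)⟩

theorem disjoint_supported {P Q : Fin D.N → Fin D.N → ℕ → Prop}
    (h : ∀ i j r, P i j r → ¬ Q i j r) : Disjoint (D.supported P) (D.supported Q) := by
  rw [Submodule.disjoint_def]
  intro x hP hQ
  refine D.eq_zero_of_coord hP.1 fun i j r => ?_
  by_cases hp : P i j r
  · exact hQ.2 i j r (h i j r hp)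
  · exact hP.2 i j r hp

theorem iSupIndep_of_le_supported {ι : Type*} {S : ι → Submodule ℂ (End ℂ V)}
    {P : ι → Fin D.N → Fin D.N → ℕ → Prop} (hS : ∀ a, S a ≤ D.supported (P a))
    (h : ∀ a b, a ≠ b → ∀ i j r, P a i j r → ¬ P b i j r) : iSupIndep S := by
  intro a
  refine Disjoint.mono (hS a) (iSup₂_le fun b hb => (hS b).trans (D.supported_mono
    (Q := fun i j r => ¬ P a i j r) fun i j r hP => h b a hb i j r hP))
    (D.disjoint_supported fun i j r hP => not_not.mpr hP)

theorem xi_mem_supported {P : Fin D.N → Fin D.N → ℕ → Prop} {i j : Fin D.N} {r : ℕ}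
    (h : D.lam j ≤ D.lam i + r) (hP : P i j r) : D.xi i j r ∈ D.supported P := by
  refine ⟨D.commute_xi h, fun l m s hs => ?_⟩
  rw [D.coord_xi, if_neg]
  rintro ⟨rfl, rfl, rfl, _⟩
  exact hs hP

theorem N₁_le_supported : D.N₁ ≤ D.supported fun i j _ => j ≠ i ∧ j = D.star i := by
  refine Submodule.span_le.mpr ?_
  rintro _ ⟨i, k, -, hi, -, rfl⟩
  exact D.xi_mem_supported (by rw [D.lam_star]; omega) ⟨hi.symm, rfl⟩

theorem N₂_le_supported : D.N₂ ≤ D.supported fun i j _ => j ≠ i ∧ j ≠ D.star i := by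
  refine Submodule.span_le.mpr ?_
  rintro _ ⟨i, j, k, hk, hij, hj, rfl⟩
  rw [lt_min_iff] at hk
  refine add_mem (D.xi_mem_supported (by omega) ⟨hij.ne', hj⟩) (Submodule.smul_mem _ _
    (D.xi_mem_supported (by rw [D.lam_star, D.lam_star]; omega) ⟨fun h => ?_, fun h => ?_⟩))
  · exact hij.ne (D.star_injective h)
  · rw [D.star_star] at h; exact hj h.symm

theorem 𝔑₁_le_supported : D.𝔑₁ ≤ D.supported fun i j r => j = i ∧ Even r := by
  refine Submodule.span_le.mpr ?_
  rintro _ ⟨i, k, hk, hi, hodd, rfl⟩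
  have hs : Even (D.lam i - 1 - k) := by
    rw [Nat.odd_iff] at hodd; rw [Nat.even_iff]; omega
  exact sub_mem (D.xi_mem_supported (by omega) ⟨rfl, hs⟩)
    (D.xi_mem_supported (by omega) ⟨rfl, hs⟩)

theorem 𝔑₀_le_supported : D.𝔑₀ ≤ D.supported fun i j r => j = i ∧ Odd r := by
  refine Submodule.span_le.mpr ?_
  rintro _ (⟨i, k, hk, hi, heven, rfl⟩ | ⟨i, k, hk, hi, heven, rfl⟩)
  all_goals
    have hs : Odd (D.lam i - 1 - k) := by
      rw [Nat.even_iff] at heven; rw [Nat.odd_iff]; omega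
  · exact D.xi_mem_supported (by omega) ⟨rfl, hs⟩
  · exact add_mem (D.xi_mem_supported (by omega) ⟨rfl, hs⟩)
      (D.xi_mem_supported (by omega) ⟨rfl, hs⟩)

theorem N₂Plus_le_N₂ : D.N₂Plus ≤ D.N₂ := Submodule.span_mono Set.sdiff_subset

/-- The four summands involve disjoint sets of ξ_i^{j,r}, separated by whether j is i, i* or
neither, and for j = i by the parity of r. -/
theorem iSupIndep_summands (S : Submodule ℂ (End ℂ V)) :
    iSupIndep ![D.N₁, D.N₂Plus, D.𝔑₁, D.𝔑₀ ⊓ S] := by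
  refine D.iSupIndep_of_le_supported (P := ![fun i j _ => j ≠ i ∧ j = D.star i,
    fun i j _ => j ≠ i ∧ j ≠ D.star i, fun i j r => j = i ∧ Even r, fun i j r => j = i ∧ Odd r])
    (fun a => ?_) (fun a b hab i j r => ?_)
  · fin_cases a
    · exact D.N₁_le_supported
    · exact D.N₂Plus_le_N₂.trans D.N₂_le_supported
    · exact D.𝔑₁_le_supported
    · exact inf_le_left.trans D.𝔑₀_le_supported
  · have := Nat.not_even_iff_odd (n := r)
    fin_cases a <;> fin_cases b <;> simp at hab ⊢ <;> grind

/-! ### The coefficients that vanish on the derived algebra -/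

/-- The pairs of indices of the basis of `N_2^-`. -/
def IsMinusPair (i j : Fin D.N) : Prop :=
  (j : ℕ) = i + 1 ∧ i = D.star i ∧ j = D.star j ∧
    (∀ l : Fin D.N, (l : ℕ) + 1 = i → D.lam i < D.lam l) ∧
    (∀ l : Fin D.N, (l : ℕ) = j + 1 → D.lam l < D.lam j)

/-- The coefficient of `v j` in the image of `v i`. -/
def lead (i j : Fin D.N) : End ℂ V →ₗ[ℂ] ℂ := D.coord j 0 ∘ₗ LinearMap.applyₗ (D.v i)

theorem lead_apply (i j : Fin D.N) (x : End ℂ V) : D.lead i j x = D.coord j 0 (x (D.v i)) := rfl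

variable {D} in
theorem IsMinusPair.lt {i j : Fin D.N} (h : D.IsMinusPair i j) : i < j := by
  have := h.1
  rw [Fin.lt_def]; omega

/-- An endomorphism commuting with e acts on V/eV, and `lead` gives the entries of its matrix there.
-/
theorem lead_mul {x y : End ℂ V} (hx : Commute e x) (i j : Fin D.N) :
    D.lead i j (x * y) = ∑ l, D.lead i l y * D.lead l j x := by
  rw [lead_apply, Module.End.mul_apply]
  conv_lhs => rw [← D.sum_coord (y (D.v i))]
  simp only [map_sum, map_smul]
  refine Finset.sum_congr rfl fun l _ => ?_
  rw [Finset.sum_eq_single 0]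
  · simp [lead_apply]
  · intro r _ hr
    rw [pow_apply_of_commute hx, ← D.sum_coord (x (D.v l))]
    simp only [map_sum, map_smul, ← Module.End.mul_apply, ← pow_add, D.coord_pow]
    simp [hr]
  · intro h
    exact absurd (Finset.mem_range.mpr (D.lam_pos l)) h

theorem lead_eq_zero {x : End ℂ V} (hx : Commute e x) {i j : Fin D.N} (h : D.lam i < D.lam j) :
    D.lead i j x = 0 :=
  D.coord_eq_zero_of_commute hx (by omega)

theorem lead_eq_zero_of_supported {P : Fin D.N → Fin D.N → ℕ → Prop} {x : End ℂ V}
    (hx : x ∈ D.supported P) {i j : Fin D.N} (h : ¬ P i j 0) : D.lead i j x = 0 :=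
  hx.2 i j 0 h

variable {D} in
theorem IsMinusPair.lead_zeta {i j i' j' : Fin D.N} (h : D.IsMinusPair i j) (h' : i' < j') {k : ℕ}
    (hk : k < D.lam j') :
    D.lead i j (D.zeta i' j' k) = if i = i' ∧ j = j' ∧ k = D.lam j - 1 then 1 else 0 := by
  have hl := D.lam_pos j
  rw [lead_apply, zeta, LinearMap.add_apply, LinearMap.smul_apply, map_add, map_smul, D.coord_xi,
    D.coord_xi, if_neg (c := i = D.star j' ∧ _), smul_zero, add_zero]
  · congr 1
    -- Only the first summand of ζ can contribute: since i and j are fixed by the involution, the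
    -- second would force i' = j and j' = i, against the order.
    rw [eq_iff_iff]
    constructor
    · rintro ⟨rfl, rfl, h1, _⟩
      exact ⟨rfl, rfl, by omega⟩
    · rintro ⟨rfl, rfl, h1⟩
      exact ⟨rfl, rfl, by omega, by omega⟩
  · rintro ⟨h1, h2, _⟩
    have h3 : j' = i := by rw [h.2.1, h1, D.star_star]
    have h4 : i' = j := by rw [h.2.2.1, ← h2, D.star_star]
    subst h3 h4
    exact lt_asymm h' h.lt

theorem mem_N₂MinusSet {x : End ℂ V} : x ∈ D.N₂MinusSet ↔
    ∃ i j, D.IsMinusPair i j ∧ x = D.zeta i j (D.lam j - 1) := by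
  constructor
  · rintro ⟨i, j, h1, h2, h3, h4, h5, rfl⟩
    exact ⟨i, j, ⟨h1, h2, h3, h4, h5⟩, rfl⟩
  · rintro ⟨i, j, ⟨h1, h2, h3, h4, h5⟩, rfl⟩
    exact ⟨i, j, h1, h2, h3, h4, h5, rfl⟩

variable {D} in
theorem IsMinusPair.lead_N₂Plus {i j : Fin D.N} (h : D.IsMinusPair i j) {x : End ℂ V}
    (hx : x ∈ D.N₂Plus) : D.lead i j x = 0 := by
  have : D.N₂Plus ≤ LinearMap.ker (D.lead i j) := by
    refine Submodule.span_le.mpr ?_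
    rintro _ ⟨⟨i', j', k, hk, hij, hj, rfl⟩, hm⟩
    rw [lt_min_iff] at hk
    rw [SetLike.mem_coe, LinearMap.mem_ker, h.lead_zeta hij hk.2, if_neg]
    rintro ⟨rfl, rfl, rfl⟩
    exact hm (D.mem_N₂MinusSet.mpr ⟨i, j, h, rfl⟩)
  exact this hx

open Classical in
theorem eq_sum_lead {x : End ℂ V} (hx : x ∈ Submodule.span ℂ D.N₂MinusSet) :
    x = ∑ i, ∑ j, if D.IsMinusPair i j then D.lead i j x • D.zeta i j (D.lam j - 1) else 0 := by
  induction hx using Submodule.span_induction with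
  | mem x hx =>
    obtain ⟨i, j, h, rfl⟩ := D.mem_N₂MinusSet.mp hx
    have hl := D.lam_pos j
    rw [Finset.sum_eq_single i, Finset.sum_eq_single j]
    · rw [if_pos h, h.lead_zeta h.lt (by omega), if_pos ⟨rfl, rfl, rfl⟩, one_smul]
    · intro b _ hb
      split_ifs with h'
      · rw [h'.lead_zeta h.lt (by omega), if_neg (by tauto), zero_smul]
      · rfl
    · simp
    · intro a _ ha
      refine Finset.sum_eq_zero fun b _ => ?_
      split_ifs with h'
      · rw [h'.lead_zeta h.lt (by omega), if_neg (by tauto), zero_smul]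
      · rfl
    · simp
  | zero => simp
  | add x y _ _ hx hy =>
    conv_lhs => rw [hx, hy]
    simp only [← Finset.sum_add_distrib]
    refine Finset.sum_congr rfl fun i _ => Finset.sum_congr rfl fun j _ => ?_
    split_ifs
    · rw [map_add, add_smul]
    · simp
  | smul c x _ hx =>
    conv_lhs => rw [hx]
    simp only [Finset.smul_sum]
    refine Finset.sum_congr rfl fun i _ => Finset.sum_congr rfl fun j _ => ?_
    split_ifs
    · rw [map_smul, smul_smul, smul_eq_mul]
    · simp

/-- The functionals `lead i j` of minus pairs are dual to the basis of N_2^- and vanish on N_2^+, so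
they cut out N_2^+ inside N_2. -/
theorem mem_N₂Plus_of_lead {x : End ℂ V} (hx : x ∈ D.N₂)
    (h : ∀ i j, D.IsMinusPair i j → D.lead i j x = 0) : x ∈ D.N₂Plus := by
  have h1 : D.N₂ ≤ D.N₂Plus ⊔ Submodule.span ℂ D.N₂MinusSet := by
    rw [N₂Plus, ← Submodule.span_union, Set.sdiff_union_self]
    exact Submodule.span_mono Set.subset_union_left
  obtain ⟨y, hy, z, hz, rfl⟩ := Submodule.mem_sup.mp (h1 hx)
  have h2 : z = 0 := by
    rw [D.eq_sum_lead hz]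
    refine Finset.sum_eq_zero fun i _ => Finset.sum_eq_zero fun j _ => ?_
    split_ifs with hij
    · have := h i j hij
      rw [map_add, hij.lead_N₂Plus hy, zero_add] at this
      rw [this, zero_smul]
    · rfl
  rwa [h2, add_zero]

variable [DirectSum.Decomposition 𝒱] [FiniteDimensional ℂ V] (hβ : IsSuperForm 𝒱 β)

/-- For i = i* one has σ ξ_i^{i,0} = -ξ_i^{i,0}, so symmetrization kills this coefficient. -/
theorem lead_sxi_self (he : e ∈ glPart 𝒱 0) {i : Fin D.N} (hi : D.star i = i) {l m : Fin D.N}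
    {r : ℕ} (h : D.lam m ≤ D.lam l + r) : D.lead i i (D.sxi hβ l m r) = 0 := by
  by_cases hlm : l = i ∧ m = i
  · obtain ⟨rfl, rfl⟩ := hlm
    rw [D.sxi_self hβ he, hi, lead_apply, LinearMap.add_apply, LinearMap.smul_apply, map_add,
      map_smul, D.coord_xi]
    split_ifs with h1
    · rw [h1.2.2.1]; simp
    · simp
  · rw [D.sxi_eq hβ he h, lead_apply, LinearMap.add_apply, LinearMap.smul_apply, map_add,
      map_smul, D.coord_xi, D.coord_xi, if_neg (by tauto), if_neg, smul_zero, add_zero]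
    rintro ⟨h1, h2, _⟩
    exact hlm ⟨by rw [← D.star_star l, h2, hi], by rw [← D.star_star m, ← h1, hi]⟩

variable {D} in
-- In the sum over intermediate chains n, the terms n = i and n = j contain a vanishing diagonal
-- coefficient. Any other n precedes i and is strictly longer than chain i, or follows j and is
-- strictly shorter than chain j; commuting with e then kills one factor.
theorem IsMinusPair.lead_mul_sxi (he : e ∈ glPart 𝒱 0) {i j : Fin D.N} (hij : D.IsMinusPair i j)
    {l m p q : Fin D.N} {r s : ℕ} (h : D.lam m ≤ D.lam l + r) (h' : D.lam q ≤ D.lam p + s) :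
    D.lead i j (D.sxi hβ l m r * D.sxi hβ p q s) = 0 := by
  have hx := D.commute_sxi hβ he h
  have hy := D.commute_sxi hβ he h'
  rw [D.lead_mul hx]
  refine Finset.sum_eq_zero fun n _ => ?_
  by_cases h1 : n = i
  · rw [h1, D.lead_sxi_self hβ he hij.2.1.symm h', zero_mul]
  by_cases h2 : n = j
  · rw [h2, D.lead_sxi_self hβ he hij.2.2.1.symm h, mul_zero]
  have hadj := hij.1
  have h1' : (n : ℕ) ≠ i := fun h => h1 (Fin.ext h)
  have h2' : (n : ℕ) ≠ j := fun h => h2 (Fin.ext h)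
  by_cases h3 : (n : ℕ) < i
  · have h4 := hij.2.2.2.1 ⟨i - 1, by omega⟩ (by simp; omega)
    have h5 : D.lam ⟨i - 1, by omega⟩ ≤ D.lam n := D.lam_antitone (by rw [Fin.le_def]; simp; omega)
    rw [D.lead_eq_zero hy (by omega), zero_mul]
  · have hn := n.2
    have h4 := hij.2.2.2.2 ⟨j + 1, by omega⟩ rfl
    have h5 : D.lam n ≤ D.lam ⟨j + 1, by omega⟩ := D.lam_antitone (by rw [Fin.le_def]; simp; omega)
    rw [D.lead_eq_zero hx (by omega), mul_zero]

include hβ in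
variable {D} in
theorem IsMinusPair.lead_derived (he : e ∈ glPart 𝒱 0) {i j : Fin D.N} (hij : D.IsMinusPair i j)
    {x : End ℂ V} (hx : x ∈ bracketSpan 𝒱 (centralizer 𝒱 β e) (centralizer 𝒱 β e)) :
    D.lead i j x = 0 := by
  rw [D.derived_eq_span hβ he] at hx
  have : Submodule.span ℂ {x | ∃ i j r, D.lam j ≤ D.lam i + r ∧ ∃ l m s, D.lam m ≤ D.lam l + s ∧
        x = superBracket 𝒱 (D.sxi hβ i j r) (D.sxi hβ l m s)} ≤ LinearMap.ker (D.lead i j) := by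
    refine Submodule.span_le.mpr ?_
    rintro _ ⟨l, m, r, h, p, q, s, h', rfl⟩
    rw [SetLike.mem_coe, LinearMap.mem_ker, superBracket_of_mem (D.sxi_mem_glPart hβ he l m r)
      (D.sxi_mem_glPart hβ he p q s), map_sub, map_smul, hij.lead_mul_sxi hβ he h h',
      hij.lead_mul_sxi hβ he h' h, smul_zero, sub_zero]
  exact this hx

include hβ in
theorem derived_eq (he : e ∈ glPart 𝒱 0) :
    bracketSpan 𝒱 (centralizer 𝒱 β e) (centralizer 𝒱 β e) =
      D.N₁ ⊔ D.N₂Plus ⊔ D.𝔑₁ ⊔ (D.𝔑₀ ⊓ bracketSpan 𝒱 D.N₂ D.N₂) := by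
  refine le_antisymm (fun x hx => ?_) ?_
  · obtain ⟨y₁, hy₁, z, hz, rfl⟩ := Submodule.mem_sup.mp (D.derived_le hβ he hx)
    obtain ⟨y₂, hy₂, w, hw, rfl⟩ := Submodule.mem_sup.mp hy₁
    obtain ⟨y, hy, u, hu, rfl⟩ := Submodule.mem_sup.mp hy₂
    have hu' : u ∈ D.N₂Plus := by
      refine D.mem_N₂Plus_of_lead hu fun i j hij => ?_
      have h1 := hij.lead_derived hβ he hx
      have h2 := hij.lt.ne'
      rw [map_add, map_add, map_add,
        D.lead_eq_zero_of_supported (D.N₁_le_supported hy) fun h => h2 (h.2.trans hij.2.1.symm),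
        D.lead_eq_zero_of_supported (D.𝔑₁_le_supported hw) fun h => h2 h.1,
        D.lead_eq_zero_of_supported (D.𝔑₀_le_supported hz.1) fun h => h2 h.1] at h1
      simpa using h1
    exact add_mem (Submodule.mem_sup_left (add_mem (Submodule.mem_sup_left (add_mem
      (Submodule.mem_sup_left hy) (Submodule.mem_sup_right hu'))) (Submodule.mem_sup_right hw)))
      (Submodule.mem_sup_right hz)
  · refine sup_le (sup_le (sup_le (D.N₁_le_derived hβ he) (D.N₂Plus_le_derived hβ he))
      (D.𝔑₁_le_derived hβ he)) (inf_le_right.trans ?_)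
    have h := D.N₂_le_centralizer hβ he
    exact Submodule.span_mono fun _ ⟨x, hx, y, hy, hz⟩ => ⟨x, h hx, y, h hy, hz⟩

include hβ in
theorem N₂_inf_derived (he : e ∈ glPart 𝒱 0) :
    D.N₂ ⊓ bracketSpan 𝒱 (centralizer 𝒱 β e) (centralizer 𝒱 β e) = D.N₂Plus :=
  le_antisymm
    (fun _ hx => D.mem_N₂Plus_of_lead hx.1 fun _ _ hij => hij.lead_derived hβ he hx.2)
    (le_inf D.N₂Plus_le_N₂ (D.N₂Plus_le_derived hβ he))

end AdaptedBasis

end Coefficients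

/-! ### Normalizing one chain, or a pair of chains, of maximal length. -/

section Isotropic

variable {V : Type*} [AddCommGroup V] [Module ℂ V] {β : LinearMap.BilinForm ℂ V} {e : End ℂ V}

theorem skew_pow (hskew : ∀ u w, β (e u) w = -β u (e w)) (a : ℕ) (u w : V) :
    β ((e ^ a) u) w = (-1) ^ a * β u ((e ^ a) w) := by
  induction a generalizing w with
  | zero => simp
  | succ a ih =>
    rw [pow_succ', Module.End.mul_apply, hskew, ih, ← Module.End.mul_apply (e ^ a), ← pow_succ,
      ← pow_succ']
    ring

theorem pow_mem_of_invariant {X : Submodule ℂ V} (hX : ∀ u ∈ X, e u ∈ X) (a : ℕ) {u : V}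
    (hu : u ∈ X) : (e ^ a) u ∈ X := by
  induction a with
  | zero => simpa using hu
  | succ a ih => rw [pow_succ', Module.End.mul_apply]; exact hX _ ih

/-- An `e`-invariant subspace killed by `e ^ l` on which the form is symmetric up to the
sign `s`. -/
structure IsSignedBlock (β : LinearMap.BilinForm ℂ V) (e : End ℂ V) (X : Submodule ℂ V) (s : ℂ)
    (l : ℕ) : Prop where
  skew : ∀ u w, β (e u) w = -β u (e w)
  invariant : ∀ u ∈ X, e u ∈ X
  sq : s * s = 1
  symm : ∀ u ∈ X, ∀ w ∈ X, β u w = s * β w u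
  pow_eq_zero : ∀ u ∈ X, (e ^ l) u = 0

namespace IsSignedBlock

variable {X : Submodule ℂ V} {s : ℂ} {l : ℕ} (H : IsSignedBlock β e X s l)

include H

theorem pow_mem (a : ℕ) {u : V} (hu : u ∈ X) : (e ^ a) u ∈ X :=
  pow_mem_of_invariant H.invariant a hu

theorem form_symm {u w : V} (hu : u ∈ X) (hw : w ∈ X) (b : ℕ) :
    β u ((e ^ b) w) = s * (-1) ^ b * β w ((e ^ b) u) := by
  rw [H.symm u hu _ (H.pow_mem b hw), skew_pow H.skew, mul_assoc]

theorem form_eq_zero (u : V) {w : V} (hw : w ∈ X) {b : ℕ} (hb : l ≤ b) :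
    β u ((e ^ b) w) = 0 := by
  obtain ⟨c, rfl⟩ := Nat.exists_eq_add_of_le' hb
  rw [pow_add, Module.End.mul_apply, H.pow_eq_zero w hw, map_zero, map_zero]

theorem form_add_smul (u u' w w' : V) (c d : ℂ) (p q b : ℕ) :
    β (u + c • (e ^ p) u') ((e ^ b) (w + d • (e ^ q) w')) =
      β u ((e ^ b) w) + d * β u ((e ^ (b + q)) w') + c * (-1) ^ p * β u' ((e ^ (b + p)) w) +
        c * d * (-1) ^ p * β u' ((e ^ (b + p + q)) w') := by
  simp only [map_add, map_smul, LinearMap.add_apply, LinearMap.smul_apply, skew_pow H.skew,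
    ← Module.End.mul_apply, ← pow_add, smul_eq_mul]
  rw [add_comm p b, ← add_assoc p b q, add_comm p b]
  ring

theorem neg_one_pow_of_form_ne_zero {u : V} (hu : u ∈ X) {b : ℕ} (h : β u ((e ^ b) u) ≠ 0) :
    s * (-1) ^ b = 1 := by
  have := H.form_symm hu hu b
  exact mul_right_cancel₀ h (by rw [one_mul]; exact this.symm)

/-- In the symmetric case, there is a vector whose chain pairs with itself. -/
theorem exists_single (hl : 0 < l) (hs : s * (-1) ^ (l - 1) = 1) {x y : V} (hx : x ∈ X)
    (hy : y ∈ X) (hxy : β y ((e ^ (l - 1)) x) ≠ 0) :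
    ∃ v ∈ X, ∀ b, β v ((e ^ b) v) = if b + 1 = l then 1 else 0 := by
  -- Polarization: the form β(u, e^(l-1) w) is symmetric on X and nonzero.
  have h1 : ∃ v ∈ X, β v ((e ^ (l - 1)) v) ≠ 0 := by
    by_contra! h
    have h1 := h (x + y) (add_mem hx hy)
    simp only [map_add, LinearMap.add_apply, h x hx, h y hy] at h1
    rw [H.form_symm hx hy, hs] at h1
    apply hxy
    linear_combination h1 / 2
  obtain ⟨v, hv, hvv⟩ := h1
  obtain ⟨c, hc⟩ : ∃ c : ℂ, c ^ 2 = (β v ((e ^ (l - 1)) v))⁻¹ :=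
    IsAlgClosed.exists_pow_nat_eq _ (by norm_num)
  -- The values β(v, e^b v) are cleared downwards from b = l - 2, the top value being kept at 1.
  have key : ∀ m, ∃ v ∈ X, β v ((e ^ (l - 1)) v) = 1 ∧
      ∀ b, b + 1 < l → l ≤ b + m + 1 → β v ((e ^ b) v) = 0 := by
    intro m
    induction m with
    | zero =>
      refine ⟨c • v, X.smul_mem c hv, ?_, fun b h1 h2 => by omega⟩
      simp only [map_smul, LinearMap.smul_apply, smul_eq_mul]
      rw [← mul_assoc, ← pow_two, hc, inv_mul_cancel₀ hvv]
    | succ m ih =>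
      obtain ⟨v, hv, h1, h2⟩ := ih
      by_cases hm : l < m + 2
      · exact ⟨v, hv, h1, fun b h3 _ => h2 b h3 (by omega)⟩
      by_cases h0 : β v ((e ^ (l - 2 - m)) v) = 0
      · refine ⟨v, hv, h1, fun b h3 h4 => ?_⟩
        by_cases hb : b = l - 2 - m
        · rw [hb, h0]
        · exact h2 b h3 (by omega)
      -- By symmetry a nonzero value occurs only for b of the parity of l - 1, so the two cross
      -- terms in the correction add up. Hence the 2 in the denominator of d.
      have heven : (-1 : ℂ) ^ (m + 1) = 1 := by
        have h3 := H.neg_one_pow_of_form_ne_zero hv h0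
        have h4 : (-1 : ℂ) ^ (l - 1) = (-1) ^ (l - 2 - m) * (-1) ^ (m + 1) := by
          rw [← pow_add]; congr 1; omega
        rw [h4, ← mul_assoc, h3, one_mul] at hs
        exact hs
      set d := -(β v ((e ^ (l - 2 - m)) v)) / 2 with hd
      refine ⟨v + d • (e ^ (m + 1)) v, add_mem hv (X.smul_mem _ (H.pow_mem _ hv)), ?_,
        fun b h3 h4 => ?_⟩
      · rw [H.form_add_smul, h1, H.form_eq_zero v hv (by omega), H.form_eq_zero v hv (by omega)]
        simp
      · rw [H.form_add_smul, H.form_eq_zero v hv (b := b + (m + 1) + (m + 1)) (by omega), heven]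
        by_cases hb : b = l - 2 - m
        · rw [show b + (m + 1) = l - 1 by omega, h1, hb, hd]; ring
        · rw [h2 b h3 (by omega), H.form_eq_zero v hv (by omega)]; simp
  obtain ⟨v, hv, h1, h2⟩ := key l
  refine ⟨v, hv, fun b => ?_⟩
  split_ifs with hb
  · rw [show b = l - 1 by omega, h1]
  · by_cases hb' : b < l
    · exact h2 b (by omega) (by omega)
    · exact H.form_eq_zero v hv (by omega)

/-- In the skew case, a vector can be made isotropic by adding a combination of the chain of a
vector it pairs with. -/
theorem exists_isotropic (hs : s * (-1) ^ (l - 1) = -1) {p q : V} (hp : p ∈ X) (hq : q ∈ X)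
    (hpq : β p ((e ^ (l - 1)) q) ≠ 0) :
    ∃ f ∈ Submodule.span ℂ (Set.range fun c : ℕ => (e ^ c) p),
      β p ((e ^ (l - 1)) (q + f)) = β p ((e ^ (l - 1)) q) ∧
      ∀ b, β (q + f) ((e ^ b) (q + f)) = 0 := by
  have hX : Submodule.span ℂ (Set.range fun c : ℕ => (e ^ c) p) ≤ X :=
    Submodule.span_le.mpr (by rintro _ ⟨c, rfl⟩; exact H.pow_mem c hp)
  set t := β p ((e ^ (l - 1)) q) with ht
  have hiso : ∀ u ∈ X, β u ((e ^ (l - 1)) u) = 0 := by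
    intro u hu
    by_contra h
    have := H.neg_one_pow_of_form_ne_zero hu h
    rw [hs] at this
    norm_num at this
  have key : ∀ m, ∃ f ∈ Submodule.span ℂ (Set.range fun c : ℕ => (e ^ c) p),
      β p ((e ^ (l - 1)) (q + f)) = t ∧
      ∀ b, l ≤ b + m + 1 → β (q + f) ((e ^ b) (q + f)) = 0 := by
    intro m
    induction m with
    | zero =>
      refine ⟨0, zero_mem _, by rw [add_zero], fun b hb => ?_⟩
      rw [add_zero]
      by_cases hb' : b = l - 1
      · rw [hb', hiso q hq]
      · exact H.form_eq_zero q hq (by omega)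
    | succ m ih =>
      obtain ⟨f, hf, h1, h2⟩ := ih
      have hw : q + f ∈ X := add_mem hq (hX hf)
      by_cases hm : l < m + 2
      · exact ⟨f, hf, h1, fun b _ => h2 b (by omega)⟩
      by_cases h0 : β (q + f) ((e ^ (l - 2 - m)) (q + f)) = 0
      · refine ⟨f, hf, h1, fun b h4 => ?_⟩
        by_cases hb : b = l - 2 - m
        · rw [hb, h0]
        · exact h2 b (by omega)
      have hodd : (-1 : ℂ) ^ (m + 1) = -1 := by
        have h3 := H.neg_one_pow_of_form_ne_zero hw h0
        have h4 : (-1 : ℂ) ^ (l - 1) = (-1) ^ (l - 2 - m) * (-1) ^ (m + 1) := by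
          rw [← pow_add]; congr 1; omega
        rw [h4, ← mul_assoc, h3, one_mul] at hs
        exact hs
      -- Both cross terms equal -d t at b = l - 2 - m. The term pairing p with itself carries a
      -- power of e that is at least l, so p need not be isotropic.
      set d := β (q + f) ((e ^ (l - 2 - m)) (q + f)) / (2 * t) with hd
      refine ⟨f + d • (e ^ (m + 1)) p, add_mem hf (Submodule.smul_mem _ _
        (Submodule.subset_span ⟨m + 1, rfl⟩)), ?_, fun b h4 => ?_⟩
      · rw [← add_assoc, map_add, map_add, h1, map_smul, map_smul, ← Module.End.mul_apply,
          ← pow_add, H.form_eq_zero p hp (by omega), smul_zero, add_zero]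
      · rw [← add_assoc, H.form_add_smul,
          H.form_eq_zero p hp (b := b + (m + 1) + (m + 1)) (by omega), hodd]
        by_cases hb : b = l - 2 - m
        · rw [show b + (m + 1) = l - 1 by omega, H.form_symm hw hp, hs, h1, hb, hd]
          field_simp
          ring
        · rw [h2 b (by omega), H.form_eq_zero p hw (by omega), H.form_eq_zero _ hp (by omega)]
          simp
  obtain ⟨f, hf, h1, h2⟩ := key l
  exact ⟨f, hf, h1, fun b => h2 b (by omega)⟩

/-- In the skew case, there is a pair of vectors with isotropic dual chains. -/
theorem exists_pair (hl : 0 < l) (hs : s * (-1) ^ (l - 1) = -1) {x y : V} (hx : x ∈ X)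
    (hy : y ∈ X) (hxy : β y ((e ^ (l - 1)) x) ≠ 0) :
    ∃ u ∈ X, ∃ w ∈ X, (∀ b, β u ((e ^ b) u) = 0) ∧ (∀ b, β w ((e ^ b) w) = 0) ∧
      ∀ b, β u ((e ^ b) w) = if b + 1 = l then 1 else 0 := by
  have hX : ∀ p ∈ X, Submodule.span ℂ (Set.range fun c : ℕ => (e ^ c) p) ≤ X := fun p hp =>
    Submodule.span_le.mpr (by rintro _ ⟨c, rfl⟩; exact H.pow_mem c hp)
  obtain ⟨f, hf, hf1, hf2⟩ := H.exists_isotropic hs hy hx hxy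
  -- Adding multiples of e^(m+1) w keeps w isotropic and clears its lower pairings with y one by
  -- one.
  have key : ∀ m, ∃ w ∈ X, (∀ b, β w ((e ^ b) w) = 0) ∧ β y ((e ^ (l - 1)) w) = 1 ∧
      ∀ b, b + 1 < l → l ≤ b + m + 1 → β y ((e ^ b) w) = 0 := by
    intro m
    induction m with
    | zero =>
      refine ⟨(β y ((e ^ (l - 1)) x))⁻¹ • (x + f), X.smul_mem _ (add_mem hx (hX y hy hf)),
        fun b => ?_, ?_, fun b h1 h2 => by omega⟩
      · rw [map_smul, map_smul, map_smul, LinearMap.smul_apply, hf2, smul_zero, smul_zero]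
      · rw [map_smul, map_smul, hf1, smul_eq_mul, inv_mul_cancel₀ hxy]
    | succ m ih =>
      obtain ⟨w, hw, h1, h2, h3⟩ := ih
      by_cases hm : l < m + 2
      · exact ⟨w, hw, h1, h2, fun b h4 _ => h3 b h4 (by omega)⟩
      refine ⟨w + (-β y ((e ^ (l - 2 - m)) w)) • (e ^ (m + 1)) w,
        add_mem hw (X.smul_mem _ (H.pow_mem _ hw)), fun b => ?_, ?_, fun b h4 h5 => ?_⟩
      · rw [H.form_add_smul]; simp [h1]
      · rw [map_add, map_add, h2, map_smul, map_smul, ← Module.End.mul_apply, ← pow_add,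
          H.form_eq_zero y hw (b := l - 1 + (m + 1)) (by omega), smul_zero, add_zero]
      · rw [map_add, map_add, map_smul, map_smul, ← Module.End.mul_apply, ← pow_add]
        by_cases hb : b = l - 2 - m
        · rw [show b + (m + 1) = l - 1 by omega, h2, hb]; simp
        · rw [h3 b h4 (by omega), H.form_eq_zero y hw (b := b + (m + 1)) (by omega), smul_zero,
            add_zero]
  obtain ⟨w, hw, h1, h2, h3⟩ := key l
  -- Finally y is made isotropic by adding g from the span of the chain of w. As w is isotropic,
  -- this leaves the pairings with w unchanged.
  obtain ⟨g, hg, -, hg2⟩ := H.exists_isotropic hs hw hy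
    (by rw [H.form_symm hw hy, hs, h2]; norm_num)
  have hg3 : ∀ b, β g ((e ^ b) w) = 0 := by
    intro b
    have : Submodule.span ℂ (Set.range fun c : ℕ => (e ^ c) w) ≤
        LinearMap.ker (β.flip ((e ^ b) w)) := by
      refine Submodule.span_le.mpr ?_
      rintro _ ⟨c, rfl⟩
      show β ((e ^ c) w) ((e ^ b) w) = 0
      rw [skew_pow H.skew,
        ← Module.End.mul_apply, ← pow_add, h1, mul_zero]
    exact this hg
  refine ⟨y + g, add_mem hy (hX w hw hg), w, hw, hg2, h1, fun b => ?_⟩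
  rw [map_add, LinearMap.add_apply, hg3, add_zero]
  split_ifs with hb
  · rw [show b = l - 1 by omega, h2]
  · by_cases hb' : b < l
    · exact h3 b (by omega) (by omega)
    · exact H.form_eq_zero y hw (by omega)

end IsSignedBlock

end Isotropic

/-! ### Unordered families of chains in normal form. -/

section Families

variable {V : Type*} [AddCommGroup V] [Module ℂ V]

/-- The left side is the symmetry sign of β(u, e^(l-1) w) on vectors of parity a. It decides between
a self-paired chain and a pair of chains, in agreement with `star_eq_iff`. -/
theorem sgn_self_mul_neg_one_pow (a : ZMod 2) {l : ℕ} (hl : 0 < l) :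
    sgn a a * (-1) ^ (l - 1) = if (a = 0 ∧ Odd l) ∨ (a = 1 ∧ Even l) then 1 else -1 := by
  obtain ⟨k, rfl⟩ := Nat.exists_eq_add_of_le' hl
  rw [Nat.add_sub_cancel]
  rcases zmod_two_cases a with rfl | rfl <;> rcases Nat.even_or_odd k with h | h <;>
    simp [h.neg_one_pow, h, Nat.not_odd_iff_even.mpr, Nat.not_even_iff_odd.mpr, parity_simps]

/-- A family of Jordan chains that is a basis of its span, on which the form is in normal form, with
no order on the index set. -/
structure Chains (𝒱 : ZMod 2 → Submodule ℂ V) (β : LinearMap.BilinForm ℂ V) (e : End ℂ V)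
    (ι : Type) where
  /-- the lengths of the chains -/
  lam : ι → ℕ
  lam_pos : ∀ i, 0 < lam i
  /-- the parities of the chains -/
  par : ι → ZMod 2
  /-- the generators of the chains -/
  v : ι → V
  v_mem : ∀ i, v i ∈ 𝒱 (par i)
  pow_lam : ∀ i, (e ^ lam i) (v i) = 0
  /-- the involution pairing the chains -/
  star : ι → ι
  star_star : ∀ i, star (star i) = i
  lam_star : ∀ i, lam (star i) = lam i
  par_star : ∀ i, par (star i) = par i
  star_eq_iff : ∀ i, star i = i ↔ (par i = 0 ∧ Odd (lam i)) ∨ (par i = 1 ∧ Even (lam i))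
  /-- the signs of the form on the chains -/
  θ : ι → ℂ
  θ_eq : ∀ i, θ i = 1 ∨ θ i = -1
  form_star : ∀ i b, β (v i) ((e ^ b) (v (star i))) = if b + 1 = lam i then θ i else 0
  form_ne : ∀ i j b, j ≠ star i → β (v i) ((e ^ b) (v j)) = 0

namespace Chains

variable {𝒱 : ZMod 2 → Submodule ℂ V} {β : LinearMap.BilinForm ℂ V} {e : End ℂ V} {ι κ : Type}

/-- The empty family of chains. -/
def empty : Chains 𝒱 β e Empty where
  lam i := i.elim
  lam_pos i := i.elim
  par i := i.elim
  v i := i.elim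
  v_mem i := i.elim
  pow_lam i := i.elim
  star i := i
  star_star i := i.elim
  lam_star i := i.elim
  par_star i := i.elim
  star_eq_iff i := i.elim
  θ i := i.elim
  θ_eq i := i.elim
  form_star i := i.elim
  form_ne i := i.elim

/-- The union of two orthogonal families of chains. -/
def sum (C : Chains 𝒱 β e ι) (C' : Chains 𝒱 β e κ)
    (h : ∀ i j b, β (C.v i) ((e ^ b) (C'.v j)) = 0)
    (h' : ∀ i j b, β (C'.v i) ((e ^ b) (C.v j)) = 0) : Chains 𝒱 β e (ι ⊕ κ) where
  lam := Sum.elim C.lam C'.lam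
  lam_pos := by rintro (i | i); exacts [C.lam_pos i, C'.lam_pos i]
  par := Sum.elim C.par C'.par
  v := Sum.elim C.v C'.v
  v_mem := by rintro (i | i); exacts [C.v_mem i, C'.v_mem i]
  pow_lam := by rintro (i | i); exacts [C.pow_lam i, C'.pow_lam i]
  star := Sum.map C.star C'.star
  star_star := by rintro (i | i) <;> simp [C.star_star, C'.star_star]
  lam_star := by rintro (i | i) <;> simp [C.lam_star, C'.lam_star]
  par_star := by rintro (i | i) <;> simp [C.par_star, C'.par_star]
  star_eq_iff := by
    rintro (i | i)
    · simpa using C.star_eq_iff i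
    · simpa using C'.star_eq_iff i
  θ := Sum.elim C.θ C'.θ
  θ_eq := by rintro (i | i); exacts [C.θ_eq i, C'.θ_eq i]
  form_star := by rintro (i | i) b; exacts [C.form_star i b, C'.form_star i b]
  form_ne := by
    rintro (i | i) (j | j) b hij
    · exact C.form_ne i j b fun h => hij (by simp [h])
    · exact h i j b
    · exact h' i j b
    · exact C'.form_ne i j b fun h => hij (by simp [h])

/-- The family consisting of one chain paired with itself. -/
def single {a : ZMod 2} {l : ℕ} (hl : 0 < l) (hs : sgn a a * (-1) ^ (l - 1) = 1) {u : V}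
    (hu : u ∈ 𝒱 a) (hl' : (e ^ l) u = 0)
    (h : ∀ b, β u ((e ^ b) u) = if b + 1 = l then 1 else 0) : Chains 𝒱 β e Unit where
  lam _ := l
  lam_pos _ := hl
  par _ := a
  v _ := u
  v_mem _ := hu
  pow_lam _ := hl'
  star i := i
  star_star _ := rfl
  lam_star _ := rfl
  par_star _ := rfl
  star_eq_iff _ := by
    rw [sgn_self_mul_neg_one_pow a hl] at hs
    refine iff_of_true rfl ?_
    by_contra h
    rw [if_neg h] at hs
    norm_num at hs
  θ _ := 1
  θ_eq _ := Or.inl rfl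
  form_star _ := h
  form_ne _ _ _ h := absurd rfl h

/-- The family consisting of two isotropic chains paired with each other. -/
def pair {a : ZMod 2} {l : ℕ} (hl : 0 < l) (hs : sgn a a * (-1) ^ (l - 1) = -1) {u w : V}
    (hu : u ∈ 𝒱 a) (hw : w ∈ 𝒱 a) (hul : (e ^ l) u = 0) (hwl : (e ^ l) w = 0)
    (huu : ∀ b, β u ((e ^ b) u) = 0) (hww : ∀ b, β w ((e ^ b) w) = 0)
    (huw : ∀ b, β u ((e ^ b) w) = if b + 1 = l then 1 else 0)
    (hwu : ∀ b, β w ((e ^ b) u) = if b + 1 = l then -1 else 0) : Chains 𝒱 β e Bool where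
  lam _ := l
  lam_pos _ := hl
  par _ := a
  v i := if i then w else u
  v_mem i := by split_ifs; exacts [hw, hu]
  pow_lam i := by split_ifs; exacts [hwl, hul]
  star i := !i
  star_star := Bool.not_not
  lam_star _ := rfl
  par_star _ := rfl
  star_eq_iff i := by
    rw [sgn_self_mul_neg_one_pow a hl] at hs
    refine iff_of_false (Bool.not_ne_self i) fun h => ?_
    rw [if_pos h] at hs
    norm_num at hs
  θ i := if i then -1 else 1
  θ_eq i := by cases i <;> simp
  form_star i := by cases i; exacts [huw, hwu]
  form_ne i j b h := by
    cases i <;> cases j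
    · exact huu b
    · exact absurd rfl h
    · exact absurd rfl h
    · exact hww b

/-- Transport of a family of chains along a bijection of the index sets. -/
def reindex (C : Chains 𝒱 β e ι) (f : κ ≃ ι) : Chains 𝒱 β e κ where
  lam i := C.lam (f i)
  lam_pos i := C.lam_pos _
  par i := C.par (f i)
  v i := C.v (f i)
  v_mem i := C.v_mem _
  pow_lam i := C.pow_lam _
  star i := f.symm (C.star (f i))
  star_star i := by simp [C.star_star]
  lam_star i := by simp [C.lam_star]
  par_star i := by simp [C.par_star]
  star_eq_iff i := by rw [← C.star_eq_iff, Equiv.symm_apply_eq]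
  θ i := C.θ (f i)
  θ_eq i := C.θ_eq _
  form_star i b := by simp [C.form_star]
  form_ne i j b h := C.form_ne _ _ b fun h' => h (by rw [← h', Equiv.symm_apply_apply])

variable (C : Chains 𝒱 β e ι)

theorem pow_apply_eq_zero {i : ι} {a : ℕ} (h : C.lam i ≤ a) : (e ^ a) (C.v i) = 0 := by
  obtain ⟨c, rfl⟩ := Nat.exists_eq_add_of_le' h
  rw [pow_add, Module.End.mul_apply, C.pow_lam, map_zero]

/-- The span of a family of chains. -/
def span : Submodule ℂ V := Submodule.span ℂ {u | ∃ i b, u = (e ^ b) (C.v i)}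

theorem span_reindex (f : κ ≃ ι) : (C.reindex f).span = C.span := by
  unfold span
  congr 1
  ext u
  constructor
  · rintro ⟨i, b, rfl⟩; exact ⟨f i, b, rfl⟩
  · rintro ⟨i, b, rfl⟩; exact ⟨f.symm i, b, by simp [reindex]⟩

variable (hskew : ∀ u w, β (e u) w = -β u (e w))

include hskew

theorem form_pow_star (i : ι) (a b : ℕ) : β ((e ^ a) (C.v i)) ((e ^ b) (C.v (C.star i))) =
    if a + b + 1 = C.lam i then (-1) ^ a * C.θ i else 0 := by
  rw [skew_pow hskew, ← Module.End.mul_apply, ← pow_add, C.form_star]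
  split_ifs <;> simp

theorem form_pow_ne {i j : ι} (h : j ≠ C.star i) (a b : ℕ) :
    β ((e ^ a) (C.v i)) ((e ^ b) (C.v j)) = 0 := by
  rw [skew_pow hskew, ← Module.End.mul_apply, ← pow_add, C.form_ne i j _ h, mul_zero]

/-- Up to sign, e^(lam i - 1 - a) v_{i*} is dual to e^a v_i. This gives both linear independence and
the orthogonal projection. -/
theorem form_pow_dual [DecidableEq ι] (i j : ι) (a : Fin (C.lam i)) (b : Fin (C.lam j)) :
    β ((e ^ (b : ℕ)) (C.v j)) ((e ^ (C.lam i - 1 - a)) (C.v (C.star i))) =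
      if (⟨j, b⟩ : Σ i, Fin (C.lam i)) = ⟨i, a⟩ then (-1) ^ (a : ℕ) * C.θ i else 0 := by
  by_cases hij : j = i
  · subst hij
    have ha := a.2
    rw [C.form_pow_star hskew]
    by_cases hab : b = a
    · subst hab
      rw [if_pos rfl, if_pos (by omega)]
    · have : (b : ℕ) ≠ a := fun h => hab (Fin.ext h)
      rw [if_neg (by omega), if_neg]
      intro h
      exact hab (eq_of_heq (Sigma.mk.inj h).2)
  · rw [C.form_pow_ne hskew, if_neg fun h => hij (Sigma.mk.inj h).1]
    intro h
    exact hij (by rw [← C.star_star j, ← h, C.star_star])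

theorem linearIndependent [Fintype ι] :
    LinearIndependent ℂ fun s : Σ i, Fin (C.lam i) => (e ^ (s.2 : ℕ)) (C.v s.1) := by
  classical
  rw [Fintype.linearIndependent_iff]
  rintro g hg ⟨i, a⟩
  have h := congrArg (fun u => β u ((e ^ (C.lam i - 1 - a)) (C.v (C.star i)))) hg
  simp only [map_sum, map_smul, LinearMap.sum_apply, LinearMap.smul_apply, map_zero,
    LinearMap.zero_apply] at h
  rw [Finset.sum_eq_single ⟨i, a⟩] at h
  · rw [C.form_pow_dual hskew, if_pos rfl, smul_eq_mul] at h
    rcases C.θ_eq i with h1 | h1 <;> simpa [h1] using h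
  · rintro ⟨j, b⟩ _ hjb
    rw [C.form_pow_dual hskew, if_neg hjb, smul_zero]
  · simp

theorem sum_lam_le [Fintype ι] [FiniteDimensional ℂ V] : ∑ i, C.lam i ≤ finrank ℂ V := by
  have := (C.linearIndependent hskew).fintype_card_le_finrank
  simpa [Fintype.card_sigma] using this

/-- Every vector is the sum of an element of the span of the chains and of one orthogonal
to them. -/
theorem exists_sub_mem_span [Fintype ι] (z : V) :
    ∃ u ∈ C.span, ∀ i b, β (z - u) ((e ^ b) (C.v i)) = 0 := by
  classical
  refine ⟨∑ s : Σ i, Fin (C.lam i), ((-1) ^ (s.2 : ℕ) * C.θ s.1 *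
    β z ((e ^ (C.lam s.1 - 1 - s.2)) (C.v (C.star s.1)))) • (e ^ (s.2 : ℕ)) (C.v s.1),
    Submodule.sum_mem _ fun s _ => Submodule.smul_mem _ _ (Submodule.subset_span ⟨_, _, rfl⟩), ?_⟩
  intro i b
  by_cases hb : C.lam i ≤ b
  · rw [C.pow_apply_eq_zero hb, map_zero]
  obtain ⟨i, rfl⟩ : ∃ j, i = C.star j := ⟨C.star i, (C.star_star i).symm⟩
  rw [C.lam_star] at hb
  obtain ⟨a, rfl⟩ : ∃ a : Fin (C.lam i), b = C.lam i - 1 - a :=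
    ⟨⟨C.lam i - 1 - b, by omega⟩, by simp; omega⟩
  simp only [map_sub, LinearMap.sub_apply, map_sum, map_smul, LinearMap.sum_apply,
    LinearMap.smul_apply]
  rw [Finset.sum_eq_single ⟨i, a⟩]
  · rw [C.form_pow_dual hskew, if_pos rfl, smul_eq_mul]
    have h1 := AdaptedBasis.neg_one_pow_sq (a : ℕ)
    have h2 : C.θ i * C.θ i = 1 := by rcases C.θ_eq i with h | h <;> simp [h]
    linear_combination (-β z ((e ^ (C.lam i - 1 - a)) (C.v (C.star i)))) *
      (C.θ i * C.θ i * h1 + h2)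
  · rintro ⟨j, c⟩ _ hjc
    rw [C.form_pow_dual hskew, if_neg hjc, smul_zero]
  · simp

end Chains

end Families

/-! ### Splitting off chains until they span, and sorting them. -/

section Existence

variable {V : Type*} [AddCommGroup V] [Module ℂ V] {𝒱 : ZMod 2 → Submodule ℂ V}
variable {β : LinearMap.BilinForm ℂ V} {e : End ℂ V}

theorem skew_of_mem_ospPart [DirectSum.Decomposition 𝒱] (he : e ∈ ospPart 𝒱 β 0) (u w : V) :
    β (e u) w = -β u (e w) := by
  rw [← sum_proj 𝒱 u]
  simp only [map_sum, LinearMap.sum_apply, ← Finset.sum_neg_distrib]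
  refine Finset.sum_congr rfl fun a _ => ?_
  have := he.2 a _ (proj_mem a u) w
  rw [sgn_zero_left, one_mul] at this
  exact eq_neg_of_add_eq_zero_left this

namespace Chains

variable {ι : Type} (C : Chains 𝒱 β e ι)

/-- The orthogonal complement of a family of chains. -/
def perp : Submodule ℂ V where
  carrier := {z | ∀ i b, β z ((e ^ b) (C.v i)) = 0}
  add_mem' hx hy i b := by rw [map_add, LinearMap.add_apply, hx i b, hy i b, add_zero]
  zero_mem' i b := by simp
  smul_mem' c x hx i b := by rw [map_smul, LinearMap.smul_apply, hx i b, smul_zero]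

theorem map_mem_perp (hskew : ∀ u w, β (e u) w = -β u (e w)) {z : V} (hz : z ∈ C.perp) :
    e z ∈ C.perp := fun i b => by
  rw [hskew, ← Module.End.mul_apply, ← pow_succ', hz i, neg_zero]

theorem pow_v_mem (he : e ∈ glPart 𝒱 0) (i : ι) (b : ℕ) : (e ^ b) (C.v i) ∈ 𝒱 (C.par i) := by
  simpa using pow_mem_glPart he b _ _ (C.v_mem i)

theorem form_left_eq_zero (hβ : IsSuperForm 𝒱 β) (he : e ∈ glPart 𝒱 0) {a : ZMod 2} {z : V}
    (hz : z ∈ C.perp) (ha : z ∈ 𝒱 a) (i : ι) (b : ℕ) : β ((e ^ b) (C.v i)) z = 0 := by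
  rw [hβ.supersymmetric _ _ _ (C.pow_v_mem he i b) _ ha, hz i b, mul_zero]

variable [DirectSum.Decomposition 𝒱]

theorem form_eq_form_proj (hβ : IsSuperForm 𝒱 β) (z : V) {a : ZMod 2} {u : V} (hu : u ∈ 𝒱 a) :
    β z u = β (proj 𝒱 a z) u := by
  conv_lhs => rw [← sum_proj 𝒱 z]
  rw [map_sum, LinearMap.sum_apply, Finset.sum_eq_single a]
  · intro c _ hc
    exact hβ.even _ _ hc _ (proj_mem _ _) _ hu
  · simp

theorem proj_mem_perp (hβ : IsSuperForm 𝒱 β) (he : e ∈ glPart 𝒱 0) {z : V} (hz : z ∈ C.perp)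
    (a : ZMod 2) : proj 𝒱 a z ∈ C.perp := fun i b => by
  have hm := C.pow_v_mem he i b
  by_cases h : a = C.par i
  · rw [h, ← form_eq_form_proj hβ z hm, hz i b]
  · exact hβ.even _ _ h _ (proj_mem a z) _ hm

/-- Here l is the least exponent with e^l = 0 on the complement. Some homogeneous x there has
e^(l-1) x ≠ 0; non-degeneracy supplies a partner y, which may be projected to the complement and to
the parity of x without changing the pairing. -/
theorem exists_pairing (hβ : IsSuperForm 𝒱 β) (he : e ∈ ospPart 𝒱 β 0) (hnil : IsNilpotent e)
    [Fintype ι] (h : C.span ≠ ⊤) : ∃ l, 0 < l ∧ (∀ z ∈ C.perp, (e ^ l) z = 0) ∧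
      ∃ a, ∃ x ∈ C.perp ⊓ 𝒱 a, ∃ y ∈ C.perp ⊓ 𝒱 a, β y ((e ^ (l - 1)) x) ≠ 0 := by
  classical
  have hskew := skew_of_mem_ospPart he
  obtain ⟨z₀, hz₀, hne⟩ : ∃ z ∈ C.perp, z ≠ 0 := by
    by_contra! h0
    refine h (eq_top_iff.mpr fun z _ => ?_)
    obtain ⟨u, hu, hzu⟩ := C.exists_sub_mem_span hskew z
    rwa [sub_eq_zero.mp (h0 (z - u) hzu)]
  have hex : ∃ n, ∀ z ∈ C.perp, (e ^ n) z = 0 := by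
    obtain ⟨n, hn⟩ := hnil
    exact ⟨n, fun z _ => by rw [hn]; rfl⟩
  have hl : 0 < Nat.find hex := by
    rw [Nat.pos_iff_ne_zero]
    intro h0
    have := Nat.find_spec hex z₀ hz₀
    rw [h0] at this
    exact hne (by simpa using this)
  refine ⟨Nat.find hex, hl, Nat.find_spec hex, ?_⟩
  have hmin := Nat.find_min hex (m := Nat.find hex - 1) (by omega)
  set l := Nat.find hex
  push Not at hmin
  obtain ⟨z, hz, hzl⟩ := hmin
  obtain ⟨a, ha⟩ : ∃ a, (e ^ (l - 1)) (proj 𝒱 a z) ≠ 0 := by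
    by_contra! h0
    apply hzl
    rw [← sum_proj 𝒱 z, map_sum]
    exact Finset.sum_eq_zero fun a _ => h0 a
  have hx := C.proj_mem_perp hβ he.1 hz a
  have hxa : proj 𝒱 a z ∈ 𝒱 a := proj_mem a z
  set x := proj 𝒱 a z
  have hex' : (e ^ (l - 1)) x ∈ C.perp := pow_mem_of_invariant (fun _ => C.map_mem_perp hskew) _ hx
  have hexa : (e ^ (l - 1)) x ∈ 𝒱 a := by simpa using pow_mem_glPart he.1 (l - 1) _ _ hxa
  obtain ⟨y, hy⟩ : ∃ y, β y ((e ^ (l - 1)) x) ≠ 0 := by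
    by_contra! h0
    exact ha (hβ.nondegenerate.2 _ h0)
  obtain ⟨u, hu, hyu⟩ := C.exists_sub_mem_span hskew y
  refine ⟨a, x, ⟨hx, hxa⟩, proj 𝒱 a (y - u), ⟨C.proj_mem_perp hβ he.1 hyu a, proj_mem _ _⟩, ?_⟩
  rw [← form_eq_form_proj hβ _ hexa, map_sub, LinearMap.sub_apply]
  have : C.span ≤ LinearMap.ker (β.flip ((e ^ (l - 1)) x)) := by
    refine Submodule.span_le.mpr ?_
    rintro _ ⟨i, b, rfl⟩
    exact C.form_left_eq_zero hβ he.1 hex' hexa i b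
  have h0 : β u ((e ^ (l - 1)) x) = 0 := this hu
  rwa [h0, sub_zero]

theorem exists_larger (hβ : IsSuperForm 𝒱 β) (he : e ∈ ospPart 𝒱 β 0) (hnil : IsNilpotent e)
    [Fintype ι] (h : C.span ≠ ⊤) : ∃ (κ : Type) (_ : Fintype κ) (C' : Chains 𝒱 β e κ),
      ∑ i, C.lam i < ∑ i, C'.lam i := by
  have hskew := skew_of_mem_ospPart he
  obtain ⟨l, hl, hl0, a, x, hx, y, hy, hxy⟩ := C.exists_pairing hβ he hnil h
  have H : IsSignedBlock β e (C.perp ⊓ 𝒱 a) (sgn a a) l :=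
    { skew := hskew
      invariant := fun u hu => ⟨C.map_mem_perp hskew hu.1, by simpa using he.1 a u hu.2⟩
      sq := sgn_mul_self a a
      symm := fun u hu w hw => hβ.supersymmetric a a u hu.2 w hw.2
      pow_eq_zero := fun u hu => hl0 u hu.1 }
  have hleft : ∀ z ∈ C.perp ⊓ 𝒱 a, ∀ i b, β (C.v i) ((e ^ b) z) = 0 := fun z hz i b => by
    have hz' := H.pow_mem b hz
    exact C.form_left_eq_zero hβ he.1 hz'.1 hz'.2 i 0
  by_cases hs : sgn a a * (-1) ^ (l - 1) = 1
  · obtain ⟨v, hv, hvv⟩ := H.exists_single hl hs hx hy hxy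
    refine ⟨ι ⊕ Unit, inferInstance, C.sum (single hl hs hv.2 (hl0 v hv.1) hvv)
      (fun i _ b => hleft v hv i b) (fun _ i b => hv.1 i b), ?_⟩
    simp [sum, single, hl]
  · have hs' : sgn a a * (-1) ^ (l - 1) = -1 := by
      rw [sgn_self_mul_neg_one_pow a hl] at hs ⊢
      split_ifs at hs ⊢
      · exact absurd rfl hs
      · rfl
    obtain ⟨u, hu, w, hw, huu, hww, huw⟩ := H.exists_pair hl hs' hx hy hxy
    have hwu : ∀ b, β w ((e ^ b) u) = if b + 1 = l then -1 else 0 := by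
      intro b
      rw [H.form_symm hw hu, huw]
      split_ifs with hb
      · rw [show b = l - 1 by omega, hs', mul_one]
      · rw [mul_zero]
    refine ⟨ι ⊕ Bool, inferInstance, C.sum (pair hl hs' hu.2 hw.2 (hl0 u hu.1) (hl0 w hw.1) huu hww
      huw hwu) (fun i j b => ?_) (fun j i b => ?_), ?_⟩
    · cases j
      · exact hleft u hu i b
      · exact hleft w hw i b
    · cases j
      · exact hu.1 i b
      · exact hw.1 i b
    · simp [sum, pair, hl]

/-- The total length of a family is at most dim V, so enlarging it must stop. -/
theorem exists_span_eq_top [FiniteDimensional ℂ V] (hβ : IsSuperForm 𝒱 β)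
    (he : e ∈ ospPart 𝒱 β 0) (hnil : IsNilpotent e) :
    ∃ (κ : Type) (_ : Fintype κ) (C : Chains 𝒱 β e κ), C.span = ⊤ := by
  by_contra! h
  have key : ∀ n, ∃ (κ : Type) (_ : Fintype κ) (C : Chains 𝒱 β e κ), n ≤ ∑ i, C.lam i := by
    intro n
    induction n with
    | zero => exact ⟨Empty, inferInstance, empty, Nat.zero_le _⟩
    | succ n ih =>
      obtain ⟨κ, _, C, hC⟩ := ih
      obtain ⟨κ', _, C', hC'⟩ := C.exists_larger hβ he hnil (h κ inferInstance C)
      exact ⟨κ', _, C', by omega⟩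
  obtain ⟨κ, _, C, hC⟩ := key (finrank ℂ V + 1)
  have := C.sum_lam_le (skew_of_mem_ospPart he)
  omega

end Chains

/-! ### Sorting the chains -/

/-- Any finite type with an involution and a function to a linear order that is invariant under the
involution and injective up to it can be enumerated monotonically, with involutive pairs
adjacent. -/
theorem exists_enumeration {ι : Type} [Fintype ι] {α : Type*} [LinearOrder α] (star : ι → ι)
    (hstar : ∀ i, star (star i) = i) (f : ι → α) (hf : ∀ i, f (star i) = f i)
    (hinj : ∀ i j, f i = f j → j = i ∨ j = star i) :
    ∃ σ : Fin (Fintype.card ι) ≃ ι, (∀ i j, i ≤ j → f (σ i) ≤ f (σ j)) ∧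
      ∀ i, (σ.symm (star (σ i)) : ℕ) ≤ i + 1 ∧ (i : ℕ) ≤ σ.symm (star (σ i)) + 1 := by
  classical
  -- An arbitrary enumeration breaks ties, making the order linear.
  let key : ι → α ×ₗ Fin (Fintype.card ι) := fun i => toLex (f i, Fintype.equivFin ι i)
  have hkey : Function.Injective key := fun i j h => by
    have h1 : (f i, Fintype.equivFin ι i) = (f j, Fintype.equivFin ι j) := toLex.injective h
    exact (Fintype.equivFin ι).injective (Prod.mk.inj h1).2
  let : LinearOrder ι := LinearOrder.lift' key hkey
  have hle : ∀ i j : ι, i ≤ j → f i ≤ f j := fun i j h => by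
    have h1 : key i ≤ key j := h
    rw [Prod.Lex.le_iff] at h1
    rcases h1 with h1 | h1
    · exact h1.le
    · exact h1.1.le
  let σ : Fin (Fintype.card ι) ≃o ι := monoEquivOfFin ι rfl
  have hmono : ∀ i j, i ≤ j → f (σ i) ≤ f (σ j) := fun i j h => hle _ _ (σ.monotone h)
  have key : ∀ i, (σ.symm (star (σ i)) : ℕ) ≤ i + 1 := by
    intro i
    by_contra! h
    have hlt := (σ.symm (star (σ i))).2
    -- If the partner came after position i + 1, the element at i + 1 would share its value of f,
    -- hence be the element at i or its partner.
    set m : Fin (Fintype.card ι) := ⟨i + 1, by omega⟩ with hm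
    have h1 := hmono i m (by rw [Fin.le_def, hm]; simp)
    have h2 := hmono m (σ.symm (star (σ i))) (by rw [Fin.le_def, hm]; exact h.le)
    rw [OrderIso.apply_symm_apply, hf] at h2
    rcases hinj _ _ (le_antisymm h1 h2) with h3 | h3
    · have := σ.injective h3
      rw [Fin.ext_iff, hm] at this
      simp at this
    · rw [← h3, OrderIso.symm_apply_apply, hm] at h
      simp at h
  refine ⟨σ.toEquiv, hmono, fun i => ⟨key i, ?_⟩⟩
  have := key (σ.symm (star (σ i)))
  rwa [OrderIso.apply_symm_apply, hstar, OrderIso.symm_apply_apply] at this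

namespace Chains

variable {ι : Type} [Fintype ι]

theorem exists_sorted (C : Chains 𝒱 β e ι) : ∃ (N : ℕ) (C' : Chains 𝒱 β e (Fin N)),
    C'.span = C.span ∧ Antitone C'.lam ∧
    (∀ i j, C'.lam i = C'.lam j → C'.par i = 0 → C'.par j = 1 → i < j) ∧
    ∀ i, (C'.star i : ℕ) ≤ i + 1 ∧ (i : ℕ) ≤ C'.star i + 1 := by
  let idx := Fintype.equivFin ι
  -- The sorting key is decreasing length, then parity, then the smaller label in the orbit of the
  -- involution. The last entry makes f injective up to the involution.
  let f : ι → ℕᵒᵈ ×ₗ ℕ ×ₗ Fin (Fintype.card ι) := fun i =>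
    toLex (OrderDual.toDual (C.lam i), toLex ((C.par i).val, min (idx i) (idx (C.star i))))
  have hle : ∀ i j, f i ≤ f j → C.lam j ≤ C.lam i ∧
      (C.lam i = C.lam j → (C.par i).val ≤ (C.par j).val) := by
    intro i j h
    rw [Prod.Lex.le_iff] at h
    rcases h with h | ⟨h1, h2⟩
    · have h' : C.lam j < C.lam i := h
      exact ⟨h'.le, fun h3 => absurd h3 h'.ne'⟩
    · have h' : C.lam i = C.lam j := h1
      refine ⟨h'.ge, fun _ => ?_⟩
      rw [Prod.Lex.le_iff] at h2
      rcases h2 with h2 | h2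
      · exact h2.le
      · exact h2.1.le
  obtain ⟨σ, h1, h2⟩ := exists_enumeration C.star C.star_star f
    (fun i => by simp only [f, C.lam_star, C.par_star, C.star_star, min_comm])
    (fun i j h => by
      have h3 := toLex.injective h
      have h4 := toLex.injective (Prod.mk.inj h3).2
      have h5 : min (idx i) (idx (C.star i)) = min (idx j) (idx (C.star j)) := (Prod.mk.inj h4).2
      rcases min_choice (idx i) (idx (C.star i)) with h6 | h6 <;>
      rcases min_choice (idx j) (idx (C.star j)) with h7 | h7 <;>
      rw [h6, h7] at h5 <;> have h8 := idx.injective h5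
      · exact Or.inl h8.symm
      · right; rw [h8, C.star_star]
      · exact Or.inr h8.symm
      · left; rw [← C.star_star j, ← h8, C.star_star])
  refine ⟨_, C.reindex σ, C.span_reindex σ, fun i j hij => (hle _ _ (h1 i j hij)).1,
    fun i j hl hi hj => ?_, h2⟩
  by_contra! hij
  have h3 := (hle _ _ (h1 j i hij)).2 hl.symm
  have hi' : C.par (σ i) = 0 := hi
  have hj' : C.par (σ j) = 1 := hj
  rw [hi', hj', ZMod.val_one, ZMod.val_zero] at h3
  omega

variable {N : ℕ}

/-- An adapted basis from a sorted spanning family of chains. -/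
def toAdaptedBasis (C : Chains 𝒱 β e (Fin N)) (hskew : ∀ u w, β (e u) w = -β u (e w))
    (hspan : C.span = ⊤) (hlam : Antitone C.lam)
    (hpar : ∀ i j, C.lam i = C.lam j → C.par i = 0 → C.par j = 1 → i < j)
    (hstar : ∀ i, (C.star i : ℕ) ≤ i + 1 ∧ (i : ℕ) ≤ C.star i + 1) : AdaptedBasis 𝒱 β e where
  N := N
  lam := C.lam
  lam_pos := C.lam_pos
  lam_antitone := hlam
  par := C.par
  par_order := hpar
  v := C.v
  v_mem := C.v_mem
  pow_lam := C.pow_lam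
  basis := Basis.mk (C.linearIndependent hskew) (by
    rw [← hspan]
    refine Submodule.span_le.mpr ?_
    rintro _ ⟨i, b, rfl⟩
    by_cases hb : b < C.lam i
    · exact Submodule.subset_span ⟨⟨i, b, hb⟩, rfl⟩
    · rw [C.pow_apply_eq_zero (by omega)]
      exact zero_mem _)
  basis_apply i a := by rw [Basis.mk_apply]
  star := C.star
  star_star := C.star_star
  star_near := hstar
  lam_star := C.lam_star
  par_star := C.par_star
  star_eq_iff := C.star_eq_iff
  θ := C.θ
  θ_eq := C.θ_eq
  form_eq i j a _ b _ := by
    by_cases h : j = C.star i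
    · subst h
      rw [C.form_pow_star hskew]
      simp
    · rw [C.form_pow_ne hskew h, if_neg fun h' => h h'.1]

end Chains

theorem nonempty_adaptedBasis [DirectSum.Decomposition 𝒱] [FiniteDimensional ℂ V]
    (hβ : IsSuperForm 𝒱 β) (he : e ∈ ospPart 𝒱 β 0) (hnil : IsNilpotent e) :
    Nonempty (AdaptedBasis 𝒱 β e) := by
  obtain ⟨κ, _, C, hC⟩ := Chains.exists_span_eq_top hβ he hnil
  obtain ⟨N, C', h1, h2, h3, h4⟩ := C.exists_sorted
  exact ⟨C'.toAdaptedBasis (skew_of_mem_ospPart he) (h1.trans hC) h2 h3 h4⟩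

end Existence

end OspCentralizer

end

theorem mainTheorem9 {V : Type*} [AddCommGroup V] [Module ℂ V] [FiniteDimensional ℂ V]
    (𝒱 : ZMod 2 → Submodule ℂ V) [DirectSum.Decomposition 𝒱] (m n : ℕ)
    (hm : Module.finrank ℂ (𝒱 0) = m) (hn : Module.finrank ℂ (𝒱 1) = 2 * n)
    (β : LinearMap.BilinForm ℂ V) (hβ : OspCentralizer.IsSuperForm 𝒱 β)
    (e : Module.End ℂ V) (he : e ∈ OspCentralizer.ospPart 𝒱 β 0) (hnil : IsNilpotent e) :
    Nonempty (OspCentralizer.AdaptedBasis 𝒱 β e) ∧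
    ∀ D : OspCentralizer.AdaptedBasis 𝒱 β e,
      let ge := OspCentralizer.centralizer 𝒱 β e
      let derived := OspCentralizer.bracketSpan 𝒱 ge ge
      iSupIndep ![D.N₁, D.N₂Plus, D.𝔑₁, D.𝔑₀ ⊓ OspCentralizer.bracketSpan 𝒱 D.N₂ D.N₂] ∧
      derived = D.N₁ ⊔ D.N₂Plus ⊔ D.𝔑₁ ⊔ (D.𝔑₀ ⊓ OspCentralizer.bracketSpan 𝒱 D.N₂ D.N₂) ∧
      D.N₁ ≤ derived ∧ D.N₂ ⊓ derived = D.N₂Plus :=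
  ⟨OspCentralizer.nonempty_adaptedBasis hβ he hnil, fun D =>
    ⟨D.iSupIndep_summands _, D.derived_eq hβ he.1, D.N₁_le_derived hβ he.1,
      D.N₂_inf_derived hβ he.1⟩⟩
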